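/- Let $\mathbb T$ be the unit circle with normalised Lebesgue measure. For $1\le r\le\infty$, $H^r\subseteq L^r=L^r(\mathbb T)$ is the Hardy space, $(L^r)^n,(H^r)^n$ are the column vectors of length $n$ with entries in $L^r,H^r$, and $L^{(r,n\times n)}$ is the space of $n\times n$ matrices with entries in $L^r$. For $f\in (H^r)^n$, $f(0)$ is the value at $0$ of its analytic extension to the disc, $S^*f=(f-f(0))/z$, and $(\overline{H^r_0})^n=\{\overline f: f\in (H^r)^n,\ f(0)=0\}$. Let $\Theta$ be an $n\times n$ matrix inner function (entries in $H^\infty$, unitary a.e. on $\mathbb T$), let $K_\Theta=\Theta(\overline{H^2_0})^n\cap (H^2)^n$, and let $P_\Theta$ be the orthogonal projection of $(L^2)^n$ onto $K_\Theta$. For $G\in L^{(2,n\times n)}$, $A_G^\Theta$ is called a matrix-valued truncated Toeplitz operator (MTTO) if $f\mapsto P_\Theta(Gf)$, $f\in K_\Theta\cap (H^\infty)^n$, is bounded in the norm of $(L^2)^n$; then $A_G^\Theta:K_\Theta\to K_\Theta$ denotes its unique bounded extension. Let $M$ be a closed subspace of $(H^2)^n$. A finite-dimensional subspace $D\subseteq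 (H^2)^n$ is a defect space for $M$ if $S^*f\in M+D$ for every $f\in M$ with $f(0)=0$. $M$ is nearly $S^*$-invariant with defect $m$ if it has an $m$-dimensional defect space orthogonal to $M$ (so that $S^*f\in M\oplus D$). **Theorem.** Let $p\in(2,\infty]$, $\frac1q=\frac12+\frac1p$, and let $G\in L^{(p,n\times n)}$ be such that $A_G^\Theta$ is an MTTO. Then $\ker A_G^\Theta$ is a closed subspace of $(H^2)^n$ that is nearly $S^*$-invariant with defect $m$ for some $m\le n$. Moreover, let $P_{s+}$ ($1<s<\infty$) be the Riesz projection of $(L^s)^n=(H^s)^n\oplus(\overline{H^s_0})^n$ onto $(H^s)^n$, and let $T_{\mathcal G}$, $\mathcal G=\begin{pmatrix}\Theta^*&0\\ G&\Theta\end{pmatrix}$, be the operator on $(H^2)^n\times (H^q)^n$ given by $T_{\mathcal G}(f_1,f_2)=\big(P_{2+}(\Theta^*f_1),\,P_{q+}(Gf_1+\Theta f_2)\big)$. Let $W_1,\dots,W_r\in\ker T_{\mathcal G}$ be such that $W_1(0),\dots,W_r(0)$ is a basis of $\{F(0):F\in\ker T_{\mathcal G}\}\subseteq\mathbb C^{2n}$,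 and let $P_nW_i\in (H^2)^n$ be the first $n$ coordinates of $W_i$. Then $$D=\frac{\operatorname{span}\{P_nW_1,\dots,P_nW_r\}}{z}\cap (H^2)^n$$ is a defect space for $\ker A_G^\Theta$, and $\dim D\le n$. -/

import Mathlib

open MeasureTheory AddCircle
open scoped ENNReal

noncomputable section

namespace MTTO

/-- Normalised Lebesgue measure `m` on the unit circle. The circle is parametrised by
`t ↦ z = exp (2 π i t)`, `t ∈ ℝ / ℤ`, so that `fourier k` is the function `z ^ k`. -/
abbrev circleMeasure : Measure UnitAddCircle := haarAddCircle

/-- The scalar space `L^r` of the unit circle. -/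
abbrev LpCircle (r : ℝ≥0∞) := Lp ℂ r circleMeasure

/-- `(L^r)^n`: column vectors of length `n` with entries in `L^r`. For `r = 2` the norm is the
Hilbert space norm `‖f‖² = ∑ ‖f i‖²`. -/
abbrev LpVec (r : ℝ≥0∞) (n : ℕ) := PiLp 2 (fun _ : Fin n => LpCircle r)

/-- `L^{(r, n × n)}`: `n × n` matrices with entries in `L^r`. -/
abbrev LpMat (r : ℝ≥0∞) (n : ℕ) := Matrix (Fin n) (Fin n) (LpCircle r)

/-- The inclusion `L^r ⊆ L^q` for `q ≤ r`. -/
def incl {q r : ℝ≥0∞} (h : q ≤ r) : LpCircle r →ₗ[ℂ] LpCircle q where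
  toFun f := ⟨f.1, Lp.antitone h f.2⟩
  map_add' _ _ := rfl
  map_smul' _ _ := rfl

/-- The inclusion `(L^r)^n ⊆ (L^q)^n` for `q ≤ r`. -/
def inclVec {q r : ℝ≥0∞} (h : q ≤ r) (n : ℕ) : LpVec r n →ₗ[ℂ] LpVec q n where
  toFun f := WithLp.toLp 2 fun i => incl h (f i)
  map_add' f g := PiLp.ext fun i => (incl h).map_add (f i) (g i)
  map_smul' c f := PiLp.ext fun i => (incl h).map_smul c (f i)

/-- The inclusion `L^{(r, n × n)} ⊆ L^{(q, n × n)}` for `q ≤ r`. -/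
def inclMat {q r : ℝ≥0∞} (h : q ≤ r) {n : ℕ} (G : LpMat r n) : LpMat q n :=
  G.map (incl h)

/-- The pointwise product `L^p × L^r → L^q`, `1/p + 1/r = 1/q`. -/
def mulLp (p r q : ℝ≥0∞) [ENNReal.HolderTriple p r q] :
    LpCircle p →ₗ[ℂ] LpCircle r →ₗ[ℂ] LpCircle q :=
  (ContinuousLinearMap.mul ℂ ℂ).holderₗ circleMeasure p r q

lemma coeFn_mulLp (p r q : ℝ≥0∞) [ENNReal.HolderTriple p r q]
    (a : LpCircle p) (f : LpCircle r) :
    (mulLp p r q a f : UnitAddCircle → ℂ) =ᵐ[circleMeasure] fun t => a t * f t := by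
  simpa [mulLp] using (ContinuousLinearMap.mul ℂ ℂ).coeFn_holder (r := q) a f

/-- Pointwise matrix-vector product `f ↦ A f`, `(L^r)^n → (L^q)^n`, for a matrix function
`A ∈ L^{(p, n × n)}`, `1/p + 1/r = 1/q`. -/
def matMul {p : ℝ≥0∞} (r q : ℝ≥0∞) [ENNReal.HolderTriple p r q] {n : ℕ} (A : LpMat p n) :
    LpVec r n →ₗ[ℂ] LpVec q n where
  toFun f := WithLp.toLp 2 fun i => (∑ j, mulLp p r q (A i j) (f j) : LpCircle q)
  map_add' f g := by
    ext1 i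
    have h : (∑ j, mulLp p r q (A i j) (f j + g j) : LpCircle q) =
        ∑ j, mulLp p r q (A i j) (f j) + ∑ j, mulLp p r q (A i j) (g j) := by
      rw [← Finset.sum_add_distrib]
      exact Finset.sum_congr rfl fun j _ => (mulLp p r q (A i j)).map_add (f j) (g j)
    exact h
  map_smul' c f := by
    ext1 i
    have h : (∑ j, mulLp p r q (A i j) (c • f j) : LpCircle q) =
        c • ∑ j, mulLp p r q (A i j) (f j) := by
      rw [Finset.smul_sum]
      exact Finset.sum_congr rfl fun j _ => (mulLp p r q (A i j)).map_smul c (f j)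
    exact h

lemma coeFn_matMul {p : ℝ≥0∞} (r q : ℝ≥0∞) [ENNReal.HolderTriple p r q] {n : ℕ}
    (A : LpMat p n) (f : LpVec r n) (i : Fin n) :
    (matMul r q A f i : UnitAddCircle → ℂ) =ᵐ[circleMeasure]
      fun t => ∑ j, A i j t * f j t := by
  have h1 : ∀ᵐ t ∂circleMeasure, ∀ j, mulLp p r q (A i j) (f j) t = A i j t * f j t :=
    ae_all_iff.2 fun j => coeFn_mulLp p r q (A i j) (f j)
  have h2 := Lp.coeFn_finsetSum Finset.univ (fun j => mulLp p r q (A i j) (f j))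
  filter_upwards [h1, h2] with t h1 h2
  have h3 : matMul r q A f i = (∑ j, mulLp p r q (A i j) (f j) : LpCircle q) := rfl
  rw [h3, h2]
  simp [h1]

/-- The `k`-th Fourier coefficient, as a linear functional on `L^r`, `r ≥ 1`. -/
def coeff (r : ℝ≥0∞) [hr : Fact (1 ≤ r)] (k : ℤ) : LpCircle r →ₗ[ℂ] ℂ where
  toFun f := fourierCoeff f k
  map_add' f g := by
    rw [fourierCoeff_congr_ae (Lp.coeFn_add f g),
      fourierCoeff.add ((Lp.memLp f).integrable hr.out) ((Lp.memLp g).integrable hr.out)]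
    rfl
  map_smul' c f := by
    rw [fourierCoeff_congr_ae (Lp.coeFn_smul c f), fourierCoeff.const_smul]
    rfl

/-- The Hardy space `H^r` of the circle: functions in `L^r` whose Fourier coefficients of negative
index vanish. -/
def hardy (r : ℝ≥0∞) [Fact (1 ≤ r)] : Submodule ℂ (LpCircle r) where
  carrier := {f | ∀ k : ℤ, k < 0 → coeff r k f = 0}
  add_mem' ha hb k hk := by simp [ha k hk, hb k hk]
  zero_mem' k _ := by simp
  smul_mem' c f hf k hk := by simp [hf k hk]

/-- `(H^r)^n`. -/
def hardyVec (r : ℝ≥0∞) [Fact (1 ≤ r)] (n : ℕ) : Submodule ℂ (LpVec r n) where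
  carrier := {f | ∀ i, f i ∈ hardy r}
  add_mem' ha hb i := add_mem (ha i) (hb i)
  zero_mem' _ := zero_mem _
  smul_mem' c _ hf i := (hardy r).smul_mem c (hf i)

/-- The value `f(0) ∈ ℂ^n` of (the analytic extension to the disc of) `f ∈ (H^r)^n`: the vector of
zeroth Fourier (Taylor) coefficients. -/
def evalZero (r : ℝ≥0∞) [Fact (1 ≤ r)] (n : ℕ) : LpVec r n →ₗ[ℂ] (Fin n → ℂ) where
  toFun f i := coeff r 0 (f i)
  map_add' f g := by ext i; simp
  map_smul' c f := by ext i; simp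

lemma star_add_Lp {r : ℝ≥0∞} (f g : LpCircle r) : star (f + g) = star f + star g := by
  apply Lp.ext
  filter_upwards [Lp.coeFn_star (f + g), Lp.coeFn_star f, Lp.coeFn_star g, Lp.coeFn_add f g,
    Lp.coeFn_add (star f) (star g)] with t h1 h2 h3 h4 h5
  rw [h1, h5, Pi.star_apply, Pi.add_apply, h2, h3, h4, Pi.add_apply, star_add]
  rfl

lemma star_smul_Lp {r : ℝ≥0∞} (c : ℂ) (f : LpCircle r) : star (c • f) = star c • star f := by
  apply Lp.ext
  filter_upwards [Lp.coeFn_star (c • f), Lp.coeFn_star f, Lp.coeFn_smul c f,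
    Lp.coeFn_smul (star c) (star f)] with t h1 h2 h3 h4
  rw [h1, h4, Pi.star_apply, Pi.smul_apply, h2, h3, Pi.smul_apply, star_smul]
  rfl

lemma star_zero_Lp {r : ℝ≥0∞} : star (0 : LpCircle r) = 0 := by
  simpa using star_smul_Lp (0 : ℂ) (0 : LpCircle r)

/-- `(conj H^r_0)^n`: the functions whose complex conjugate lies in `(H^r)^n` and vanishes
at `0`. -/
def conjHardyZeroVec (r : ℝ≥0∞) [Fact (1 ≤ r)] (n : ℕ) : Submodule ℂ (LpVec r n) where
  carrier := {f | ∀ i, star (f i) ∈ hardy r ∧ coeff r 0 (star (f i)) = 0}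
  add_mem' {f g} hf hg i := by
    have h : star ((f + g) i) = star (f i) + star (g i) := star_add_Lp _ _
    rw [h]
    exact ⟨add_mem (hf i).1 (hg i).1, by simp [(hf i).2, (hg i).2]⟩
  zero_mem' i := by
    have h : star ((0 : LpVec r n) i) = 0 := star_zero_Lp
    rw [h]
    exact ⟨zero_mem _, by simp⟩
  smul_mem' c f hf i := by
    have h : star ((c • f) i) = star c • star (f i) := star_smul_Lp _ _
    rw [h]
    exact ⟨(hardy r).smul_mem _ (hf i).1, by simp [(hf i).2]⟩

/-- An `n × n` matrix inner function: a matrix with entries in `H^∞` which is unitary almost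
everywhere on the circle. -/
structure InnerMatrix (n : ℕ) where
  /-- The boundary function. -/
  toMat : LpMat ∞ n
  mem_hardy : ∀ i j, toMat i j ∈ hardy ∞
  unitary : ∀ᵐ t ∂circleMeasure,
    (Matrix.of fun i j => toMat i j t) ∈ Matrix.unitaryGroup (Fin n) ℂ

namespace InnerMatrix

variable {n : ℕ} (Θ : InnerMatrix n)

/-- Multiplication by `Θ` on `(L^r)^n`. -/
def mul (r : ℝ≥0∞) : LpVec r n →ₗ[ℂ] LpVec r n := matMul r r Θ.toMat

/-- Multiplication by `Θ^*` (pointwise conjugate transpose) on `(L^r)^n`. -/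
def adjMul (r : ℝ≥0∞) : LpVec r n →ₗ[ℂ] LpVec r n := matMul r r Θ.toMat.conjTranspose

/-- The model space `K_Θ = Θ (conj H^2_0)^n ∩ (H^2)^n`. -/
def modelSpace : Submodule ℂ (LpVec 2 n) :=
  (conjHardyZeroVec 2 n).map (Θ.mul 2) ⊓ hardyVec 2 n

lemma coeFn_adjMul (r : ℝ≥0∞) (f : LpVec r n) (i : Fin n) :
    (Θ.adjMul r f i : UnitAddCircle → ℂ) =ᵐ[circleMeasure]
      fun t => ∑ j, star (Θ.toMat j i t) * f j t := by
  have h1 : ∀ᵐ t ∂circleMeasure, ∀ j, (star (Θ.toMat j i) : LpCircle ∞) t =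
      star (Θ.toMat j i t) := ae_all_iff.2 fun j => Lp.coeFn_star _
  filter_upwards [coeFn_matMul r r Θ.toMat.conjTranspose f i, h1] with t h2 h1
  change matMul r r Θ.toMat.conjTranspose f i t = _
  rw [h2]
  simp [Matrix.conjTranspose_apply, h1]

lemma mul_adjMul (r : ℝ≥0∞) (f : LpVec r n) : Θ.mul r (Θ.adjMul r f) = f := by
  ext1 i
  apply Lp.ext
  have h := ae_all_iff.2 fun j => Θ.coeFn_adjMul r f j
  filter_upwards [coeFn_matMul r r Θ.toMat (Θ.adjMul r f) i, h, Θ.unitary] with t h1 h2 h3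
  change matMul r r Θ.toMat (Θ.adjMul r f) i t = _
  rw [h1]
  have h4 := congrArg (fun M => M.mulVec (fun j => f j t) i) (Matrix.mem_unitaryGroup_iff.1 h3)
  simp only [Matrix.one_mulVec, ← Matrix.mulVec_mulVec] at h4
  simpa [Matrix.mulVec, dotProduct, h2, Matrix.star_apply] using h4

lemma adjMul_mul (r : ℝ≥0∞) (f : LpVec r n) : Θ.adjMul r (Θ.mul r f) = f := by
  ext1 i
  apply Lp.ext
  have h := ae_all_iff.2 fun j => coeFn_matMul r r Θ.toMat f j
  filter_upwards [Θ.coeFn_adjMul r (Θ.mul r f) i, h, Θ.unitary] with t h1 h2 h3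
  rw [h1]
  have h4 := congrArg (fun M => M.mulVec (fun j => f j t) i) (Matrix.mem_unitaryGroup_iff'.1 h3)
  simp only [Matrix.one_mulVec, ← Matrix.mulVec_mulVec] at h4
  simpa [Matrix.mulVec, dotProduct, h2, Matrix.star_apply, mul] using h4

end InnerMatrix

lemma continuous_coeff (k : ℤ) : Continuous (coeff 2 k) := by
  have h : (fun f => coeff 2 k f) = fun f : LpCircle 2 => inner ℂ (fourierLp 2 k) f := by
    ext f
    change fourierCoeff f k = _
    rw [← fourierBasis_repr, fourierBasis.repr_apply_apply, coe_fourierBasis]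
  change Continuous (fun f => coeff 2 k f)
  rw [h]
  fun_prop

lemma continuous_star_Lp : Continuous (fun f : LpCircle 2 => star f) := by
  refine (AddMonoidHomClass.isometry_of_norm
    (AddMonoidHom.mk' (fun f : LpCircle 2 => star f) star_add_Lp) fun f => ?_).continuous
  change ‖star f‖ = ‖f‖
  refine le_antisymm (Lp.norm_le_norm_of_ae_le ?_) (Lp.norm_le_norm_of_ae_le ?_) <;>
  · filter_upwards [Lp.coeFn_star f] with t h
    simp [h]

lemma isClosed_hardyVec (n : ℕ) : IsClosed (hardyVec 2 n : Set (LpVec 2 n)) := by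
  have h : (hardyVec 2 n : Set (LpVec 2 n)) =
      ⋂ (i : Fin n) (k : ℤ) (_ : k < 0), {f | coeff 2 k (f i) = 0} := by
    ext f; simp [hardyVec, hardy]
  rw [h]
  refine isClosed_iInter fun i => isClosed_iInter fun k => isClosed_iInter fun _ => ?_
  exact isClosed_eq ((continuous_coeff k).comp (PiLp.continuous_apply 2 _ i)) continuous_const

lemma isClosed_conjHardyZeroVec (n : ℕ) :
    IsClosed (conjHardyZeroVec 2 n : Set (LpVec 2 n)) := by
  have h : (conjHardyZeroVec 2 n : Set (LpVec 2 n)) =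
      ⋂ (i : Fin n), ((⋂ (k : ℤ) (_ : k < 0), {f | coeff 2 k (star (f i)) = 0}) ∩
        {f | coeff 2 0 (star (f i)) = 0}) := by
    ext f; simp [conjHardyZeroVec, hardy]
  have hc : ∀ (i : Fin n) (k : ℤ), IsClosed {f : LpVec 2 n | coeff 2 k (star (f i)) = 0} :=
    fun i k => isClosed_eq ((continuous_coeff k).comp
      (continuous_star_Lp.comp (PiLp.continuous_apply 2 _ i))) continuous_const
  rw [h]
  exact isClosed_iInter fun i =>
    (isClosed_iInter fun k => isClosed_iInter fun _ => hc i k).inter (hc i 0)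

lemma continuous_matMul {n : ℕ} (A : LpMat ∞ n) : Continuous (matMul 2 2 A) := by
  refine (PiLp.continuous_toLp 2 _).comp (continuous_pi fun i => ?_)
  have h : ∀ j, Continuous fun f : LpVec 2 n => mulLp ∞ 2 2 (A i j) (f j) := fun j =>
    ((ContinuousLinearMap.mul ℂ ℂ).holderL circleMeasure ∞ 2 2 (A i j)).continuous.comp
      (PiLp.continuous_apply 2 _ j)
  have h2 : Continuous fun f : LpVec 2 n => (∑ j, mulLp ∞ 2 2 (A i j) (f j) : LpCircle 2) :=
    continuous_finsetSum Finset.univ fun j _ => h j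
  exact h2

lemma InnerMatrix.isClosed_modelSpace {n : ℕ} (Θ : InnerMatrix n) :
    IsClosed (Θ.modelSpace : Set (LpVec 2 n)) := by
  have h : (Θ.modelSpace : Set (LpVec 2 n)) =
      (Θ.adjMul 2 ⁻¹' (conjHardyZeroVec 2 n)) ∩ hardyVec 2 n := by
    ext f
    simp only [modelSpace, Submodule.coe_inf, Submodule.map_coe, Set.mem_inter_iff,
      Set.mem_image, Set.mem_preimage]
    refine and_congr_left fun _ => ⟨?_, fun hf => ⟨_, hf, Θ.mul_adjMul 2 f⟩⟩
    rintro ⟨g, hg, rfl⟩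
    rwa [Θ.adjMul_mul]
  rw [h]
  exact ((isClosed_conjHardyZeroVec n).preimage (continuous_matMul _)).inter (isClosed_hardyVec n)

instance {n : ℕ} (Θ : InnerMatrix n) : CompleteSpace Θ.modelSpace :=
  Θ.isClosed_modelSpace.isComplete.completeSpace_coe

section TruncatedToeplitz

variable {n : ℕ} (Θ : InnerMatrix n) (G : LpMat 2 n)

/-- `K_Θ ∩ (H^∞)^n`, as a space of bounded functions. -/
def boundedModel : Submodule ℂ (LpVec ∞ n) :=
  hardyVec ∞ n ⊓ Θ.modelSpace.comap (inclVec le_top n)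

/-- The inclusion of `K_Θ ∩ (H^∞)^n` into `K_Θ`. -/
def boundedModelIncl : boundedModel Θ →ₗ[ℂ] Θ.modelSpace :=
  (inclVec le_top n).restrict fun _ hf => hf.2

/-- The map `f ↦ P_Θ (G f)` from `K_Θ ∩ (H^∞)^n` to `K_Θ`, where `P_Θ` is the orthogonal projection
of `(L^2)^n` onto `K_Θ`. -/
def truncatedMap : boundedModel Θ →ₗ[ℂ] Θ.modelSpace :=
  Θ.modelSpace.orthogonalProjectionOnto.toLinearMap ∘ₗ matMul ∞ 2 G ∘ₗ (boundedModel Θ).subtype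

/-- `A_G^Θ` is a matrix-valued truncated Toeplitz operator: the densely defined map
`f ↦ P_Θ (G f)` is bounded for the norm of `(L^2)^n`. -/
def IsMTTO : Prop :=
  ∃ C : ℝ, ∀ f : boundedModel Θ, ‖truncatedMap Θ G f‖ ≤ C * ‖boundedModelIncl Θ f‖

/-- The matrix-valued truncated Toeplitz operator `A_G^Θ : K_Θ → K_Θ`: the continuous extension of
`f ↦ P_Θ (G f)` from the dense subspace `K_Θ ∩ (H^∞)^n` (when that map is bounded). -/
def mtto : Θ.modelSpace →L[ℂ] Θ.modelSpace :=
  (truncatedMap Θ G).extendOfNorm (boundedModelIncl Θ)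

/-- `ker A_G^Θ`, as a subspace of `(L^2)^n`. -/
def kerMTTO : Submodule ℂ (LpVec 2 n) :=
  (LinearMap.ker (mtto Θ G).toLinearMap).map Θ.modelSpace.subtype

end TruncatedToeplitz

section BlockToeplitz

open Classical in
/-- The Riesz projection `P_{q+} : (L^q)^n → (H^q)^n`, `1 < q < ∞`, i.e. the projection along the
decomposition `(L^q)^n = (H^q)^n ⊕ (conj H^q_0)^n`. By M. Riesz's theorem every `g` has a
decomposition, so the `else` branch is never taken in this range of `q`. -/
def rieszProj (q : ℝ≥0∞) [Fact (1 ≤ q)] (n : ℕ) (g : LpVec q n) : LpVec q n :=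
  if h : ∃ u ∈ hardyVec q n, g - u ∈ conjHardyZeroVec q n then h.choose else g

/-- The block Toeplitz operator `T_𝒢` on `(H^2)^n × (H^q)^n`, where `𝒢 = [[Θ^*, 0], [G, Θ]]`,
`G ∈ L^{(p, n × n)}` and `1/p + 1/2 = 1/q`:
`T_𝒢 (f₁, f₂) = (P_{2+} (Θ^* f₁), P_{q+} (G f₁ + Θ f₂))`. -/
def blockToeplitz {p : ℝ≥0∞} (q : ℝ≥0∞) [Fact (1 ≤ q)] [ENNReal.HolderTriple p 2 q] {n : ℕ}
    (Θ : InnerMatrix n) (G : LpMat p n) (F : hardyVec 2 n × hardyVec q n) :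
    LpVec 2 n × LpVec q n :=
  (rieszProj 2 n (Θ.adjMul 2 F.1), rieszProj q n (matMul 2 q G F.1 + Θ.mul q F.2))

/-- `ker T_𝒢`. -/
def kerBlockToeplitz {p : ℝ≥0∞} (q : ℝ≥0∞) [Fact (1 ≤ q)] [ENNReal.HolderTriple p 2 q] {n : ℕ}
    (Θ : InnerMatrix n) (G : LpMat p n) : Set (hardyVec 2 n × hardyVec q n) :=
  {F | blockToeplitz q Θ G F = 0}

/-- The value `F(0) ∈ ℂ^n × ℂ^n = ℂ^{2n}` of `F ∈ (H^2)^n × (H^q)^n`. -/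
def evalZeroPair (q : ℝ≥0∞) [Fact (1 ≤ q)] (n : ℕ) :
    hardyVec 2 n × hardyVec q n →ₗ[ℂ] (Fin n → ℂ) × (Fin n → ℂ) :=
  (evalZero 2 n ∘ₗ (hardyVec 2 n).subtype).prodMap (evalZero q n ∘ₗ (hardyVec q n).subtype)

end BlockToeplitz

section NearInvariance

variable {n : ℕ}

/-- Division by the independent variable, `f ↦ f / z`, on `(L^2)^n`. -/
def divZ (n : ℕ) : LpVec 2 n →ₗ[ℂ] LpVec 2 n where
  toFun f := WithLp.toLp 2 fun i => mulLp ∞ 2 2 (fourierLp ∞ (-1)) (f i)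
  map_add' f g := PiLp.ext fun i => (mulLp ∞ 2 2 (fourierLp ∞ (-1))).map_add (f i) (g i)
  map_smul' c f := PiLp.ext fun i => (mulLp ∞ 2 2 (fourierLp ∞ (-1))).map_smul c (f i)

/-- The constant function with value `c ∈ ℂ^n`. -/
def constVec (c : Fin n → ℂ) : LpVec 2 n :=
  WithLp.toLp 2 fun i => c i • fourierLp 2 0

/-- The backward shift `S^* f = (f - f(0)) / z`. -/
def backwardShift (f : LpVec 2 n) : LpVec 2 n :=
  divZ n (f - constVec (evalZero 2 n f))

/-- `D` is a (finite-dimensional) defect space for `M`: if `f ∈ M` and `f(0) = 0`,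
then `S^* f ∈ M + D`. -/
structure IsDefectSpace (M D : Submodule ℂ (LpVec 2 n)) : Prop where
  le_hardy : D ≤ hardyVec 2 n
  finite : FiniteDimensional ℂ D
  backwardShift_mem : ∀ f ∈ M, evalZero 2 n f = 0 → backwardShift f ∈ M ⊔ D

/-- `M` is a closed subspace of `(H^2)^n` which is nearly `S^*`-invariant with defect `m`: there is
an `m`-dimensional defect space `D`, orthogonal to `M`, such that `S^* f ∈ M ⊕ D` for all `f ∈ M`
with `f(0) = 0`. -/
structure IsNearlyInvariantWithDefect (M : Submodule ℂ (LpVec 2 n)) (m : ℕ) : Prop where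
  le_hardy : M ≤ hardyVec 2 n
  isClosed : IsClosed (M : Set (LpVec 2 n))
  exists_defect : ∃ D : Submodule ℂ (LpVec 2 n),
    IsDefectSpace M D ∧ M ⟂ D ∧ Module.finrank ℂ D = m

/-- The space `(span {P_n W_1, …, P_n W_r} / z) ∩ (H^2)^n`. -/
def explicitDefect {q : ℝ≥0∞} [Fact (1 ≤ q)] {r : ℕ}
    (W : Fin r → hardyVec 2 n × hardyVec q n) : Submodule ℂ (LpVec 2 n) :=
  (Submodule.span ℂ (Set.range fun i => ((W i).1 : LpVec 2 n))).map (divZ n) ⊓ hardyVec 2 n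

end NearInvariance

end MTTO

end

namespace MTTO

/-! ### Fourier coefficients and uniqueness -/

section FourierCoefficients

variable {r : ℝ≥0∞} [hr : Fact (1 ≤ r)]

/-! The point is that $\ker A_G^\Theta$ is the first-component projection of the kernel of a
Toeplitz operator (`mem_kerMTTO_iff`). Indeed $f\in K_\Theta$ lies in the kernel iff $Gf\in L^q$
annihilates $K_\Theta\cap (H^\infty)^n$, and this annihilator is $\Theta
(H^q)^n+(\overline{H^q_0})^n$ (`forall_pair_eq_zero_iff`), so that $Gf+\Theta u$ is co-analytic for
some $u\in (H^q)^n$.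

Kernels of Toeplitz operators allow division by $z$: if $F\in\ker T_{\mathcal G}$ and $F(0)=0$, then
$F/z\in\ker T_{\mathcal G}$, because $\overline{H_0}$ is stable under $\bar z$
(`exists_div_mem_kerBlock`). If only $f(0)=0$ is known, lift $f$ to $F=(f,u)$ and choose $\sum
a_iW_i$ with the same value at $0$. Dividing $F-\sum a_iW_i$ by $z$ writes $f/z$ as an element of
the kernel plus $\sum a_iP_nW_i/z\in D$. An element of $D$ comes from a vector $a$ for which the
first half of $\sum a_iW_i(0)$ vanishes; the second half then determines $a$, whence $\dim D\le n$
(`finrank_ker_le`). Projecting $D$ onto the orthogonal complement of the kernel makes the defect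
space orthogonal.

The analytic input is the M. Riesz theorem for $1<q\le2$ (`exists_analyticProjection`), which
produces $u$ and justifies products of Hardy functions. The test functions are $P_\Theta(z^ke_j)$,
which are bounded (`modelVec`). -/

lemma integrable_Lp (f : LpCircle r) : Integrable f circleMeasure :=
  (Lp.memLp f).integrable hr.out

lemma coeff_eq_integral (k : ℤ) (f : LpCircle r) :
    coeff r k f = ∫ t, fourier (-k) t * f t ∂circleMeasure := rfl

lemma coeff_congr {s : ℝ≥0∞} [Fact (1 ≤ s)] {f : LpCircle r} {g : LpCircle s}
    (h : (f : UnitAddCircle → ℂ) =ᵐ[circleMeasure] g) (k : ℤ) : coeff r k f = coeff s k g :=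
  congrFun (fourierCoeff_congr_ae h) k

lemma norm_coeff_le (k : ℤ) (f : LpCircle r) : ‖coeff r k f‖ ≤ ‖f‖ := by
  rw [coeff_eq_integral]
  refine (norm_integral_le_integral_norm _).trans ?_
  have h1 : ∀ t, ‖fourier (-k) t * f t‖ = ‖f t‖ := fun t => by
    rw [norm_mul, fourier_apply, Circle.norm_coe, one_mul]
  simp_rw [h1]
  rw [integral_norm_eq_lintegral_enorm (Lp.aestronglyMeasurable f), Lp.norm_def,
    ← eLpNorm_one_eq_lintegral_enorm]
  exact ENNReal.toReal_mono (Lp.eLpNorm_ne_top f)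
    (eLpNorm_le_eLpNorm_of_exponent_le hr.out (Lp.aestronglyMeasurable f))

/-- The `k`-th Fourier coefficient as a continuous linear functional. -/
noncomputable def coeffL (r : ℝ≥0∞) [Fact (1 ≤ r)] (k : ℤ) : LpCircle r →L[ℂ] ℂ :=
  (coeff r k).mkContinuous 1 fun f => by simpa using norm_coeff_le k f

@[simp] lemma coeffL_apply (k : ℤ) (f : LpCircle r) : coeffL r k f = coeff r k f := rfl

lemma coeff_fourierLp (j k : ℤ) : coeff r k (fourierLp r j) = if k = j then 1 else 0 := by
  change fourierCoeff (fourierLp r j) k = _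
  rw [fourierCoeff_congr_ae (coeFn_fourierLp r j), fourierCoeff_fourier, Pi.single_apply]

lemma coeff_star (k : ℤ) (f : LpCircle r) :
    coeff r k (star f) = star (coeff r (-k) f) := by
  rw [coeff_eq_integral, coeff_eq_integral]
  change _ = (starRingEnd ℂ) _
  rw [← integral_conj]
  refine integral_congr_ae ?_
  filter_upwards [Lp.coeFn_star f] with t ht
  rw [ht, map_mul, ← fourier_neg, neg_neg]
  rfl

lemma coeff_fourierLp_mul (j k : ℤ) (f : LpCircle r) :
    coeff r k (mulLp ∞ r r (fourierLp ∞ j) f) = coeff r (k - j) f := by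
  rw [coeff_eq_integral, coeff_eq_integral]
  refine integral_congr_ae ?_
  filter_upwards [coeFn_mulLp ∞ r r (fourierLp ∞ j) f, coeFn_fourierLp ∞ j] with t h1 h2
  rw [h1, h2, ← mul_assoc, ← fourier_add]
  congr 3
  ring

@[simp] lemma coeff_incl {q : ℝ≥0∞} [Fact (1 ≤ q)] (h : q ≤ r) (k : ℤ) (f : LpCircle r) :
    coeff q k (incl h f) = coeff r k f := rfl

/-- The measure $f\,dm$ annihilates trigonometric polynomials, hence continuous functions by
density. Continuous approximations of the indicator of a closed set then give $\int_s f=0$ for every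
closed $s$. -/
lemma eq_zero_of_coeff_eq_zero {f : LpCircle r} (hf : ∀ k, coeff r k f = 0) : f = 0 := by
  have hint := integrable_Lp f
  have hmul : ∀ g : C(UnitAddCircle, ℂ), Integrable (fun t => g t * f t) circleMeasure :=
    fun g => hint.bdd_mul (c := ‖g‖) g.continuous.aestronglyMeasurable
      (ae_of_all _ fun t => g.norm_coe_le_norm t)
  let Λ : C(UnitAddCircle, ℂ) →ₗ[ℂ] ℂ :=
    { toFun g := ∫ t, g t * f t ∂circleMeasure
      map_add' g h := by
        simp only [ContinuousMap.add_apply, add_mul]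
        exact integral_add (hmul g) (hmul h)
      map_smul' c g := by
        simp only [ContinuousMap.smul_apply, smul_eq_mul, mul_assoc, RingHom.id_apply]
        exact integral_const_mul _ _ }
  let ΛL : C(UnitAddCircle, ℂ) →L[ℂ] ℂ := Λ.mkContinuous (∫ t, ‖f t‖ ∂circleMeasure) fun g => by
    refine (norm_integral_le_integral_norm _).trans ?_
    rw [mul_comm, ← integral_const_mul]
    refine integral_mono (hmul g).norm (hint.norm.const_mul _) fun t => ?_
    simp only [norm_mul]
    gcongr
    exact g.norm_coe_le_norm t
  have hΛ : ΛL = 0 := by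
    refine ContinuousLinearMap.ext_on
      ((Submodule.dense_iff_topologicalClosure_eq_top).2 span_fourier_closure_eq_top) ?_
    rintro _ ⟨k, rfl⟩
    have := hf (-k)
    rw [coeff_eq_integral, neg_neg] at this
    exact this
  have hΛ' : ∀ g : C(UnitAddCircle, ℂ), ∫ t, g t * f t ∂circleMeasure = 0 := fun g =>
    congrArg (fun φ : C(UnitAddCircle, ℂ) →L[ℂ] ℂ => φ g) hΛ
  rw [Lp.eq_zero_iff_ae_eq_zero]
  refine ae_eq_zero_of_forall_setIntegral_isClosed_eq_zero hint fun s hs => ?_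
  let g : ℕ → C(UnitAddCircle, ℂ) := fun n =>
    ⟨fun t => ((hs.apprSeq n t : ℝ) : ℂ), by fun_prop⟩
  have hlim : Filter.Tendsto (fun n => ∫ t, g n t * f t ∂circleMeasure) Filter.atTop
      (nhds (∫ t, s.indicator f t ∂circleMeasure)) := by
    refine tendsto_integral_of_dominated_convergence (fun t => ‖f t‖)
      (fun n => (hmul (g n)).aestronglyMeasurable) hint.norm (fun n => ae_of_all _ fun t => ?_)
      (ae_of_all _ fun t => ?_)
    · have h1 : ‖g n t‖ ≤ 1 := by
        have := HasOuterApproxClosed.apprSeq_apply_le_one hs n t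
        simpa [g] using this
      rw [norm_mul]
      exact mul_le_of_le_one_left (norm_nonneg _) h1
    · have h1 := (tendsto_pi_nhds.1 (HasOuterApproxClosed.tendsto_apprSeq hs)) t
      have h2 : Filter.Tendsto (fun n => g n t) Filter.atTop
          (nhds (((s.indicator (fun _ => (1 : NNReal)) t : NNReal) : ℝ) : ℂ)) :=
        (Complex.continuous_ofReal.tendsto _).comp ((NNReal.continuous_coe.tendsto _).comp h1)
      have h3 := h2.mul_const (f t)
      by_cases hts : t ∈ s <;> simpa [hts] using h3
  rw [← integral_indicator hs.measurableSet]
  refine tendsto_nhds_unique hlim ?_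
  simp [hΛ']

lemma ext_coeff {f g : LpCircle r} (h : ∀ k, coeff r k f = coeff r k g) : f = g :=
  sub_eq_zero.1 (eq_zero_of_coeff_eq_zero fun k => by rw [map_sub, h, sub_self])

lemma mem_hardy {f : LpCircle r} : f ∈ hardy r ↔ ∀ k < 0, coeff r k f = 0 := Iff.rfl

lemma star_mem_hardy_iff {f : LpCircle r} :
    star f ∈ hardy r ∧ coeff r 0 (star f) = 0 ↔ ∀ k, 0 ≤ k → coeff r k f = 0 := by
  simp only [mem_hardy, coeff_star, star_eq_zero]
  constructor
  · rintro ⟨h1, h2⟩ k hk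
    rcases hk.eq_or_lt with rfl | hk
    · simpa using h2
    · simpa using h1 (-k) (by lia)
  · intro h
    exact ⟨fun k hk => h _ (by lia), h _ (by lia)⟩

lemma mem_conjHardyZeroVec {n : ℕ} {f : LpVec r n} :
    f ∈ conjHardyZeroVec r n ↔ ∀ i, ∀ k, 0 ≤ k → coeff r k (f i) = 0 :=
  forall_congr' fun _ => star_mem_hardy_iff

lemma eq_zero_of_mem_hardyVec_of_mem_conjHardyZeroVec {n : ℕ} {f : LpVec r n}
    (h1 : f ∈ hardyVec r n) (h2 : f ∈ conjHardyZeroVec r n) : f = 0 := by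
  ext1 i
  refine eq_zero_of_coeff_eq_zero fun k => ?_
  rcases lt_or_ge k 0 with hk | hk
  · exact h1 i k hk
  · exact mem_conjHardyZeroVec.1 h2 i k hk

/-- No boundedness theorem is needed: a co-analytic $g$ has the decomposition $0+g$, and in the
default branch the value is $g$ itself, which is zero only if $g$ is. -/
lemma rieszProj_eq_zero_iff {n : ℕ} {g : LpVec r n} :
    rieszProj r n g = 0 ↔ g ∈ conjHardyZeroVec r n := by
  unfold rieszProj
  split_ifs with h
  · constructor
    · intro h0
      simpa [h0] using h.choose_spec.2
    · intro hg
      refine eq_zero_of_mem_hardyVec_of_mem_conjHardyZeroVec h.choose_spec.1 ?_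
      simpa using sub_mem hg h.choose_spec.2
  · constructor
    · rintro rfl
      exact zero_mem _
    · intro hg
      exact absurd ⟨0, zero_mem _, by simpa using hg⟩ h

end FourierCoefficients

/-! ### The pointwise inequality behind the M. Riesz theorem -/

section RieszInequality

/-- Near $\pi/2$ the angle $q\varphi$ lies beyond $\pi/2$ but not beyond $\pi$, so $-\cos q\varphi$
is bounded below by a positive constant and $B$ does the work; away from $\pi/2$, $\cos\varphi$ is
bounded below and $A$ absorbs the rest. -/
lemma exists_one_le_cos_rpow_sub_cos_mul {q : ℝ} (h1 : 1 < q) (h2 : q ≤ 2) :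
    ∃ A B : ℝ, 0 ≤ A ∧ 0 ≤ B ∧ ∀ φ : ℝ, 0 ≤ φ → φ < Real.pi / 2 →
      1 ≤ A * Real.cos φ ^ q - B * Real.cos (q * φ) := by
  have hπ := Real.pi_pos
  have hq0 : 0 < q := by linarith
  -- The midpoint between the zero $\pi/(2q)$ of $\cos q\varphi$ and $\pi/2$.
  set θ := (Real.pi / (2 * q) + Real.pi / 2) / 2 with hθ
  have hqθ : q * θ = Real.pi / 4 + q * Real.pi / 4 := by rw [hθ]; field_simp; ring
  have hlt : Real.pi / (2 * q) < Real.pi / 2 := by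
    gcongr
    linarith
  have hpos : 0 < Real.pi / (2 * q) := by positivity
  have hθ0 : 0 < θ := by linarith
  have hθ2 : θ < Real.pi / 2 := by linarith
  have hc : Real.cos (q * θ) < 0 := by
    apply Real.cos_neg_of_pi_div_two_lt_of_lt <;> nlinarith
  have hcθ : 0 < Real.cos θ := Real.cos_pos_of_mem_Ioo ⟨by linarith, hθ2⟩
  set B := (-Real.cos (q * θ))⁻¹ with hB
  have hB0 : 0 < B := inv_pos.2 (neg_pos.2 hc)
  refine ⟨(1 + B) / Real.cos θ ^ q, B, by positivity, hB0.le, fun φ hφ hφ2 => ?_⟩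
  have hcφ : 0 < Real.cos φ := Real.cos_pos_of_mem_Ioo ⟨by linarith, hφ2⟩
  rcases le_or_gt θ φ with h | h
  · have h3 : Real.cos (q * φ) ≤ Real.cos (q * θ) := by
      apply Real.cos_le_cos_of_nonneg_of_le_pi
      · positivity
      · nlinarith
      · gcongr
    have h4 : B * Real.cos (q * φ) ≤ -1 := by
      calc B * Real.cos (q * φ) ≤ B * Real.cos (q * θ) := by gcongr
        _ = -1 := by rw [hB, inv_neg, neg_mul, inv_mul_cancel₀ hc.ne]
    have h5 : 0 ≤ (1 + B) / Real.cos θ ^ q * Real.cos φ ^ q := by positivity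
    linarith
  · have h3 : Real.cos θ ≤ Real.cos φ :=
      Real.cos_le_cos_of_nonneg_of_le_pi hφ (by linarith) h.le
    have h4 : 1 + B ≤ (1 + B) / Real.cos θ ^ q * Real.cos φ ^ q := by
      rw [div_mul_eq_mul_div, le_div_iff₀ (by positivity)]
      gcongr
    have h5 : B * Real.cos (q * φ) ≤ B * 1 := by
      gcongr
      exact Real.cos_le_one _
    linarith

lemma exists_norm_rpow_le_re {q : ℝ} (h1 : 1 < q) (h2 : q ≤ 2) :
    ∃ A B : ℝ, 0 ≤ A ∧ 0 ≤ B ∧ ∀ w : ℂ, 0 < w.re →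
      ‖w‖ ^ q ≤ A * w.re ^ q - B * (w ^ (q : ℂ)).re := by
  obtain ⟨A, B, hA, hB, h⟩ := exists_one_le_cos_rpow_sub_cos_mul h1 h2
  refine ⟨A, B, hA, hB, fun w hw => ?_⟩
  have hw0 : w ≠ 0 := by rintro rfl; simp at hw
  have harg : |w.arg| < Real.pi / 2 := Complex.abs_arg_lt_pi_div_two_iff.2 (Or.inl hw)
  have hc := h |w.arg| (abs_nonneg _) harg
  have hre : w.re = ‖w‖ * Real.cos |w.arg| := by
    rw [Real.cos_abs, Complex.cos_arg hw0]
    field_simp [norm_ne_zero_iff.2 hw0]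
  have hcos : 0 ≤ Real.cos |w.arg| :=
    Real.cos_nonneg_of_mem_Icc ⟨by linarith [abs_nonneg w.arg, Real.pi_pos], harg.le⟩
  have hpow : (w ^ (q : ℂ)).re = ‖w‖ ^ q * Real.cos (q * |w.arg|) := by
    rw [Complex.cpow_ofReal_re, ← Real.cos_abs (w.arg * q), abs_mul,
      abs_of_pos (by linarith : 0 < q), mul_comm q]
  rw [hpow, hre, Real.mul_rpow (norm_nonneg _) hcos]
  have := mul_le_mul_of_nonneg_left hc (Real.rpow_nonneg (norm_nonneg w) q)
  linarith

lemma integral_comp_fourier_one (f : ℂ → ℂ) :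
    ∫ t, f (fourier 1 t) ∂circleMeasure = Real.circleAverage f 0 1 := by
  rw [integral_haarAddCircle, ← AddCircle.intervalIntegral_preimage 1 0, Real.circleAverage_def]
  have h' := intervalIntegral.integral_comp_mul_left
    (f := fun θ => f (circleMap 0 1 θ)) (a := 0) (b := 1) (c := 2 * Real.pi) (by positivity)
  rw [mul_zero, mul_one] at h'
  rw [← h', zero_add, inv_one, one_smul]
  refine intervalIntegral.integral_congr fun x _ => ?_
  simp only [fourier_coe_apply, circleMap]
  congr 1
  push_cast
  simp only [zero_add, one_mul, div_one, mul_one]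
  congr 1
  ring

/-- The restriction of a polynomial to the unit circle. -/
noncomputable def circlePoly (P : Polynomial ℂ) : C(UnitAddCircle, ℂ) :=
  ⟨fun t => P.eval (fourier 1 t), by fun_prop⟩

lemma circlePoly_apply (P : Polynomial ℂ) (t : UnitAddCircle) :
    circlePoly P t = P.eval (fourier 1 t) := rfl

lemma exists_fourier_one_eq {z : ℂ} (hz : ‖z‖ = 1) :
    ∃ t : UnitAddCircle, fourier 1 t = z := by
  refine ⟨((Complex.arg z / (2 * Real.pi) : ℝ) : UnitAddCircle), ?_⟩
  rw [fourier_coe_apply]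
  have h := Complex.norm_mul_exp_arg_mul_I z
  rw [hz, Complex.ofReal_one, one_mul] at h
  rw [← h]
  congr 1
  have : (Real.pi : ℂ) ≠ 0 := Complex.ofReal_ne_zero.2 Real.pi_ne_zero
  rw [h]
  push_cast
  field_simp

/-- Maximum principle for $e^{-P}$, whose modulus is $e^{-\operatorname{Re}P}$. -/
lemma le_re_eval_of_le_re_circlePoly {P : Polynomial ℂ} {m : ℝ}
    (h : ∀ t, m ≤ (circlePoly P t).re) {z : ℂ} (hz : z ∈ Metric.closedBall (0 : ℂ) 1) :
    m ≤ (P.eval z).re := by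
  have hd : Differentiable ℂ fun z => Complex.exp (-P.eval z) := by fun_prop
  have h1 : ‖Complex.exp (-P.eval z)‖ ≤ Real.exp (-m) := by
    refine Complex.norm_le_of_forall_mem_frontier_norm_le (U := Metric.ball (0 : ℂ) 1)
      Metric.isBounded_ball hd.diffContOnCl (fun w hw => ?_) ?_
    · rw [frontier_ball _ one_ne_zero, mem_sphere_zero_iff_norm] at hw
      obtain ⟨t, rfl⟩ := exists_fourier_one_eq hw
      rw [Complex.norm_exp, Complex.neg_re]
      exact Real.exp_le_exp.2 (neg_le_neg (h t))
    · rwa [closure_ball _ one_ne_zero]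
  rw [Complex.norm_exp, Complex.neg_re] at h1
  linarith [Real.exp_le_exp.1 h1]

/-- $P$ maps the closed disc into the right half-plane, so $P^q$ is holomorphic and its mean over
the circle is $P(0)^q$. As $P(0)$ is real and positive, the $B$ term of the integrated inequality
has a favourable sign and can be dropped. -/
lemma integral_norm_rpow_circlePoly_le {q A B : ℝ} (hB : 0 ≤ B) (hq : 0 ≤ q)
    (hAB : ∀ w : ℂ, 0 < w.re → ‖w‖ ^ q ≤ A * w.re ^ q - B * (w ^ (q : ℂ)).re)
    {P : Polynomial ℂ} {m : ℝ} (hm : 0 < m) (h : ∀ t, m ≤ (circlePoly P t).re)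
    (h0 : (P.eval 0).im = 0) :
    ∫ t, ‖circlePoly P t‖ ^ q ∂circleMeasure ≤ A * ∫ t, (circlePoly P t).re ^ q ∂circleMeasure := by
  have hpos : ∀ z ∈ Metric.closedBall (0 : ℂ) 1, 0 < (P.eval z).re := fun z hz =>
    hm.trans_le (le_re_eval_of_le_re_circlePoly h hz)
  have hd : DiffContOnCl ℂ (fun z => P.eval z ^ (q : ℂ)) (Metric.ball (0 : ℂ) |1|) := by
    refine DifferentiableOn.diffContOnCl fun z hz => ?_
    rw [abs_one, closure_ball _ one_ne_zero] at hz
    refine DifferentiableAt.differentiableWithinAt ?_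
    exact (P.differentiable z).cpow_const (Or.inl (hpos z hz))
  have hmean := integral_comp_fourier_one fun z => P.eval z ^ (q : ℂ)
  rw [hd.circleAverage] at hmean
  have hcont : Continuous fun t => circlePoly P t ^ (q : ℂ) :=
    (circlePoly P).continuous.cpow continuous_const fun t => Or.inl (hm.trans_le (h t))
  have hre : ∫ t, (circlePoly P t ^ (q : ℂ)).re ∂circleMeasure = (P.eval 0 ^ (q : ℂ)).re := by
    rw [← hmean]
    exact integral_re (𝕜 := ℂ) (hcont.integrable_of_hasCompactSupport
      (HasCompactSupport.of_compactSpace _))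
  have hre0 : 0 ≤ (P.eval 0 ^ (q : ℂ)).re := by
    have h1 : P.eval 0 = ((P.eval 0).re : ℂ) := Complex.ext rfl h0
    rw [h1, ← Complex.ofReal_cpow (hpos 0 (by simp)).le, Complex.ofReal_re]
    exact Real.rpow_nonneg (hpos 0 (by simp)).le _
  have hint : ∀ {u : UnitAddCircle → ℝ}, Continuous u → Integrable u circleMeasure := fun hu =>
    hu.integrable_of_hasCompactSupport (HasCompactSupport.of_compactSpace _)
  have hi2 : Continuous fun t => (circlePoly P t).re ^ q :=
    (Complex.continuous_re.comp (circlePoly P).continuous).rpow_const fun t => Or.inr hq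
  have hi3 : Continuous fun t => (circlePoly P t ^ (q : ℂ)).re :=
    Complex.continuous_re.comp hcont
  calc ∫ t, ‖circlePoly P t‖ ^ q ∂circleMeasure
      ≤ ∫ t, (A * (circlePoly P t).re ^ q - B * (circlePoly P t ^ (q : ℂ)).re) ∂circleMeasure := by
        refine integral_mono (hint ?_) (hint ?_) fun t => hAB _ (hm.trans_le (h t))
        · exact (circlePoly P).continuous.norm.rpow_const fun t => Or.inr hq
        · fun_prop
    _ = A * (∫ t, (circlePoly P t).re ^ q ∂circleMeasure) - B * (P.eval 0 ^ (q : ℂ)).re := by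
        rw [integral_sub ((hint hi2).const_mul A) ((hint hi3).const_mul B), integral_const_mul,
          integral_const_mul, hre]
    _ ≤ _ := by
        have := mul_nonneg hB hre0
        linarith

end RieszInequality

/-! ### The M. Riesz theorem for $1<q\le 2$ -/

section RieszProjection

/-- The inclusion `L^r ⊆ L^q`, `q ≤ r`, as a continuous linear map. -/
noncomputable def inclL {q r : ℝ≥0∞} [Fact (1 ≤ q)] [Fact (1 ≤ r)] (h : q ≤ r) :
    LpCircle r →L[ℂ] LpCircle q :=
  (incl h).mkContinuous 1 fun f => by
    rw [one_mul]
    exact ENNReal.toReal_mono (Lp.eLpNorm_ne_top f)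
      (eLpNorm_le_eLpNorm_of_exponent_le h (Lp.aestronglyMeasurable f))

@[simp] lemma inclL_apply {q r : ℝ≥0∞} [Fact (1 ≤ q)] [Fact (1 ≤ r)] (h : q ≤ r)
    (f : LpCircle r) : inclL h f = incl h f := rfl

/-- The class in `L^q` of a continuous function. -/
noncomputable abbrev contToLp (q : ℝ≥0∞) [Fact (1 ≤ q)] : C(UnitAddCircle, ℂ) →L[ℂ] LpCircle q :=
  ContinuousMap.toLp q circleMeasure ℂ

lemma coeFn_contToLp (q : ℝ≥0∞) [Fact (1 ≤ q)] (f : C(UnitAddCircle, ℂ)) :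
    (contToLp q f : UnitAddCircle → ℂ) =ᵐ[circleMeasure] f :=
  ContinuousMap.coeFn_toLp (p := q) circleMeasure f

lemma norm_contToLp_le (q : ℝ≥0∞) [Fact (1 ≤ q)] (f : C(UnitAddCircle, ℂ)) :
    ‖contToLp q f‖ ≤ ‖f‖ := by
  refine Lp.norm_le_of_ae_bound (μ := circleMeasure) (norm_nonneg f) ?_ |>.trans ?_
  · filter_upwards [coeFn_contToLp q f] with t ht
    rw [ht]
    exact f.norm_coe_le_norm t
  · simp [measureUnivNNReal]

lemma norm_contToLp {q : ℝ≥0∞} [hq : Fact (1 ≤ q)] (hq' : q ≠ ∞) (f : C(UnitAddCircle, ℂ)) :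
    ‖contToLp q f‖ = (∫ t, ‖f t‖ ^ q.toReal ∂circleMeasure) ^ q.toReal⁻¹ := by
  have h0 : q ≠ 0 := (zero_lt_one.trans_le hq.out).ne'
  rw [Lp.norm_def, (Lp.memLp _).eLpNorm_eq_integral_rpow_norm h0 hq', ENNReal.toReal_ofReal]
  · congr 1
    refine integral_congr_ae ?_
    filter_upwards [coeFn_contToLp q f] with t ht
    rw [ht]
  · exact Real.rpow_nonneg (integral_nonneg fun t => Real.rpow_nonneg (norm_nonneg _) _) _

lemma circlePoly_monomial (n : ℕ) (a : ℂ) :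
    circlePoly (Polynomial.monomial n a) = a • fourier (n : ℤ) := by
  ext t
  simp [circlePoly_apply, fourier_apply, AddCircle.toCircle_nsmul]

lemma coeff_contToLp_circlePoly (q : ℝ≥0∞) [Fact (1 ≤ q)] (P : Polynomial ℂ) (k : ℤ) :
    coeff q k (contToLp q (circlePoly P)) = if 0 ≤ k then P.coeff k.toNat else 0 := by
  induction P using Polynomial.induction_on' with
  | add P Q hP hQ =>
    have : circlePoly (P + Q) = circlePoly P + circlePoly Q := by
      ext t; simp [circlePoly_apply]
    rw [this, map_add, map_add, hP, hQ]
    split_ifs <;> simp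
  | monomial n a =>
    rw [circlePoly_monomial, map_smul, map_smul]
    have h2 := coeff_fourierLp (r := q) n k
    rw [show contToLp q (fourier (n : ℤ)) = fourierLp q n from rfl, h2, Polynomial.coeff_monomial]
    by_cases hk : 0 ≤ k
    · lift k to ℕ using hk
      simp [eq_comm]
    · have : k ≠ n := by lia
      simp [hk, this]

/-- The real part of a continuous function, as a continuous function. -/
noncomputable def reMap (f : C(UnitAddCircle, ℂ)) : C(UnitAddCircle, ℂ) :=
  ⟨fun t => ((f t).re : ℂ), by fun_prop⟩

lemma coeff_contToLp_reMap (q : ℝ≥0∞) [Fact (1 ≤ q)] (f : C(UnitAddCircle, ℂ)) (k : ℤ) :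
    coeff q k (contToLp q (reMap f)) =
      2⁻¹ * (coeff q k (contToLp q f) + star (coeff q (-k) (contToLp q f))) := by
  have h : contToLp q (reMap f) = (2⁻¹ : ℂ) • (contToLp q f + star (contToLp q f)) := by
    apply Lp.ext
    filter_upwards [coeFn_contToLp q (reMap f), coeFn_contToLp q f, Lp.coeFn_star (contToLp q f),
      Lp.coeFn_smul (2⁻¹ : ℂ) (contToLp q f + star (contToLp q f)),
      Lp.coeFn_add (contToLp q f) (star (contToLp q f))] with t h1 h2 h3 h4 h5
    rw [h1, h4, Pi.smul_apply, h5, Pi.add_apply, h3, Pi.star_apply, h2]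
    change ((f t).re : ℂ) = _
    rw [Complex.re_eq_add_conj, smul_eq_mul]
    change _ = _ * (_ + (starRingEnd ℂ) _)
    ring
  rw [h, map_smul, map_add, coeff_star, smul_eq_mul]

lemma isClosed_hardy_two : IsClosed (hardy 2 : Set (LpCircle 2)) := by
  have h : (hardy 2 : Set (LpCircle 2)) = ⋂ (k : ℤ) (_ : k < 0), {f | coeffL 2 k f = 0} := by
    ext f; simp [hardy]
  rw [h]
  exact isClosed_iInter fun k => isClosed_iInter fun _ =>
    isClosed_eq (coeffL 2 k).continuous continuous_const

instance : CompleteSpace (hardy 2) := isClosed_hardy_two.isComplete.completeSpace_coe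

lemma coeff_two_eq_inner (k : ℤ) (f : LpCircle 2) : coeff 2 k f = inner ℂ (fourierLp 2 k) f := by
  change fourierCoeff f k = _
  rw [← fourierBasis_repr, fourierBasis.repr_apply_apply, coe_fourierBasis]

lemma fourierLp_mem_hardy (r : ℝ≥0∞) [Fact (1 ≤ r)] {k : ℤ} (hk : 0 ≤ k) :
    fourierLp r k ∈ hardy r := fun j hj => by
  rw [coeff_fourierLp, if_neg (by lia)]

lemma coeff_starProjection_hardy (f : LpCircle 2) (k : ℤ) :
    coeff 2 k ((hardy 2).starProjection f) = if 0 ≤ k then coeff 2 k f else 0 := by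
  split_ifs with hk
  · have h := (hardy 2).sub_starProjection_mem_orthogonal f (fourierLp 2 k)
      (fourierLp_mem_hardy 2 hk)
    rw [← coeff_two_eq_inner, map_sub, sub_eq_zero] at h
    exact h.symm
  · exact ((hardy 2).starProjection_apply_mem f) k (not_le.1 hk)

variable {q : ℝ≥0∞} [hq : Fact (1 ≤ q)]

lemma norm_incl_starProjection_reMap_circlePoly_le {A B : ℝ} (hA : 0 ≤ A) (hB : 0 ≤ B) (h2 : q ≤ 2)
    (hAB : ∀ w : ℂ, 0 < w.re →
      ‖w‖ ^ q.toReal ≤ A * w.re ^ q.toReal - B * (w ^ (q.toReal : ℂ)).re)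
    {P : Polynomial ℂ} {m : ℝ} (hm : 0 < m) (h : ∀ t, m ≤ (circlePoly P t).re)
    (h0 : (P.eval 0).im = 0) :
    ‖inclL h2 ((hardy 2).starProjection (contToLp 2 (reMap (circlePoly P))))‖ ≤
      A ^ q.toReal⁻¹ * ‖contToLp q (reMap (circlePoly P))‖ := by
  have hq' : q ≠ ∞ := (h2.trans_lt (by simp)).ne
  have hP0 : star (P.coeff 0) = P.coeff 0 := by
    rw [Polynomial.coeff_zero_eq_eval_zero]
    exact Complex.conj_eq_iff_im.2 h0
  -- On the circle $\operatorname{Re}P=(P+\overline P)/2$, and $\overline P$ contributes only its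
  -- constant term to the analytic part; $P(0)$ is real, so this part is $(P+P(0))/2$.
  have key : inclL h2 ((hardy 2).starProjection (contToLp 2 (reMap (circlePoly P)))) =
      (2⁻¹ : ℂ) • (contToLp q (circlePoly P) +
        coeff q 0 (contToLp q (circlePoly P)) • fourierLp q 0) := by
    refine ext_coeff fun k => ?_
    rw [inclL_apply, coeff_incl, coeff_starProjection_hardy, coeff_contToLp_reMap]
    simp only [map_smul, map_add, coeff_contToLp_circlePoly, coeff_fourierLp, smul_eq_mul]
    rcases lt_trichotomy k 0 with hk | rfl | hk
    · simp [hk.not_ge, hk.ne]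
    · simp only [le_refl, if_true, neg_zero, Int.toNat_zero, hP0, mul_one]
    · simp [hk.le, hk.ne', hk.not_ge]
  have hP : ‖contToLp q (circlePoly P)‖ ≤
      A ^ q.toReal⁻¹ * ‖contToLp q (reMap (circlePoly P))‖ := by
    rw [norm_contToLp hq', norm_contToLp hq', ← Real.mul_rpow hA
      (integral_nonneg fun t => Real.rpow_nonneg (norm_nonneg _) _)]
    refine Real.rpow_le_rpow (integral_nonneg fun t => Real.rpow_nonneg (norm_nonneg _) _) ?_
      (by positivity)
    refine (integral_norm_rpow_circlePoly_le hB ENNReal.toReal_nonneg hAB hm h h0).trans_eq ?_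
    congr 2
    ext t
    change _ = ‖((circlePoly P t).re : ℂ)‖ ^ _
    rw [Complex.norm_real, Real.norm_of_nonneg (hm.le.trans (h t))]
  refine le_trans ?_ hP
  rw [key, norm_smul]
  have h3 : ‖fourierLp q 0‖ ≤ 1 := (norm_contToLp_le q (fourier 0)).trans (fourier_norm 0).le
  calc ‖(2⁻¹ : ℂ)‖ * ‖contToLp q (circlePoly P) +
        coeff q 0 (contToLp q (circlePoly P)) • fourierLp q 0‖
      ≤ 2⁻¹ * (‖contToLp q (circlePoly P)‖ + ‖contToLp q (circlePoly P)‖ * 1) := by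
        have h4 : ‖(2⁻¹ : ℂ)‖ = 2⁻¹ := by simp
        rw [h4]
        gcongr
        refine (norm_add_le _ _).trans ?_
        rw [norm_smul]
        gcongr
        exact norm_coeff_le _ _
    _ = _ := by ring

/-- On the circle $\operatorname{Re}(cz^{-n})=\operatorname{Re}(\bar c z^n)$, so negative
frequencies can be reflected. The factor $c$ lets the induction pass through complex scalars, which
do not commute with taking real parts. -/
lemma exists_circlePoly_re_eq {g : C(UnitAddCircle, ℂ)}
    (hg : g ∈ Submodule.span ℂ (Set.range (@fourier 1))) (c : ℂ) :
    ∃ P : Polynomial ℂ, (P.eval 0).im = 0 ∧ ∀ t, (circlePoly P t).re = (c * g t).re := by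
  induction hg using Submodule.span_induction generalizing c with
  | mem g hg =>
    obtain ⟨k, rfl⟩ := hg
    have hmon : ∀ (n : ℕ) (a : ℂ) (t : UnitAddCircle),
        circlePoly (Polynomial.monomial n a) t = a * fourier (n : ℤ) t := fun n a t => by
      rw [circlePoly_monomial]
      rfl
    rcases lt_trichotomy k 0 with hk | rfl | hk
    · refine ⟨Polynomial.monomial (-k).toNat ((starRingEnd ℂ) c), ?_, fun t => ?_⟩
      · rw [← Polynomial.coeff_zero_eq_eval_zero, Polynomial.coeff_monomial, if_neg (by lia)]
        rfl
      · rw [hmon, Int.toNat_of_nonneg (by lia), fourier_neg, ← map_mul, Complex.conj_re]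
    · refine ⟨Polynomial.C (c.re : ℂ), by simp, fun t => ?_⟩
      rw [circlePoly_apply, fourier_zero]
      simp
    · refine ⟨Polynomial.monomial k.toNat c, ?_, fun t => ?_⟩
      · rw [← Polynomial.coeff_zero_eq_eval_zero, Polynomial.coeff_monomial, if_neg (by lia)]
        rfl
      · rw [hmon, Int.toNat_of_nonneg hk.le]
  | zero => exact ⟨0, by simp, fun t => by simp [circlePoly_apply]⟩
  | add g₁ g₂ _ _ h₁ h₂ =>
    obtain ⟨P₁, h1, h1'⟩ := h₁ c
    obtain ⟨P₂, h2, h2'⟩ := h₂ c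
    refine ⟨P₁ + P₂, by simp [h1, h2], fun t => ?_⟩
    have e1 := h1' t
    have e2 := h2' t
    rw [circlePoly_apply] at e1 e2
    rw [circlePoly_apply, Polynomial.eval_add, Complex.add_re, e1, e2, ContinuousMap.add_apply,
      mul_add, Complex.add_re]
  | smul a g _ h =>
    obtain ⟨P, h1, h2⟩ := h (c * a)
    exact ⟨P, h1, fun t => by
      rw [h2, ContinuousMap.smul_apply, smul_eq_mul, mul_assoc]⟩

lemma exists_circlePoly_near {f : C(UnitAddCircle, ℂ)} (hf : ∀ t, 0 ≤ (f t).re)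
    {ε : ℝ} (hε : 0 < ε) :
    ∃ P : Polynomial ℂ, (P.eval 0).im = 0 ∧ (∀ t, ε ≤ (circlePoly P t).re) ∧
      ‖reMap (circlePoly P) - reMap f‖ ≤ 3 * ε := by
  have hd : f ∈ closure (Submodule.span ℂ (Set.range (@fourier 1)) : Set C(UnitAddCircle, ℂ)) :=
    (Submodule.dense_iff_topologicalClosure_eq_top).2 span_fourier_closure_eq_top f
  obtain ⟨g, hg, hfg⟩ := Metric.mem_closure_iff.1 hd ε hε
  obtain ⟨P, hP0, hP⟩ := exists_circlePoly_re_eq hg 1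
  have hclose : ∀ t, |(circlePoly P t).re - (f t).re| ≤ ε := fun t => by
    rw [hP, one_mul, ← Complex.sub_re]
    refine (Complex.abs_re_le_norm _).trans (le_trans ?_ hfg.le)
    rw [dist_comm, dist_eq_norm]
    exact (g - f).norm_coe_le_norm t
  -- The approximant has real part at least $-\varepsilon$; adding $2\varepsilon$ makes it at least
  -- $\varepsilon$, at the cost of a total error $3\varepsilon$.
  have hshift : ∀ t, (circlePoly (P + Polynomial.C ((2 * ε : ℝ) : ℂ)) t).re =
      (circlePoly P t).re + 2 * ε := fun t => by
    rw [circlePoly_apply, circlePoly_apply, Polynomial.eval_add, Polynomial.eval_C,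
      Complex.add_re, Complex.ofReal_re]
  refine ⟨P + Polynomial.C ((2 * ε : ℝ) : ℂ), ?_, fun t => ?_, ?_⟩
  · rw [Polynomial.eval_add, Polynomial.eval_C, Complex.add_im, hP0, Complex.ofReal_im, add_zero]
  · have := abs_le.1 (hclose t)
    rw [hshift]
    linarith [hf t]
  · refine (ContinuousMap.norm_le _ (by positivity)).2 fun t => ?_
    change ‖((circlePoly (P + Polynomial.C ((2 * ε : ℝ) : ℂ)) t).re : ℂ) - ((f t).re : ℂ)‖ ≤ _
    rw [hshift, ← Complex.ofReal_sub, Complex.norm_real, Real.norm_eq_abs, abs_le]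
    have := abs_le.1 (hclose t)
    constructor <;> linarith

lemma exists_norm_incl_starProjection_le (h1 : 1 < q) (h2 : q ≤ 2) :
    ∃ C : ℝ, ∀ f : LpCircle 2, ‖inclL h2 ((hardy 2).starProjection f)‖ ≤ C * ‖inclL h2 f‖ := by
  have hq' : q ≠ ∞ := (h2.trans_lt (by simp)).ne
  have hr1 : 1 < q.toReal := by
    simpa using (ENNReal.toReal_lt_toReal (by simp) hq').2 h1
  have hr2 : q.toReal ≤ 2 := by
    simpa using (ENNReal.toReal_le_toReal hq' (by simp)).2 h2
  obtain ⟨A, B, hA, hB, hAB⟩ := exists_norm_rpow_le_re hr1 hr2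
  set C := A ^ q.toReal⁻¹ with hC
  have hC0 : 0 ≤ C := Real.rpow_nonneg hA _
  let T : C(UnitAddCircle, ℂ) →L[ℂ] LpCircle q :=
    (inclL h2).comp ((hardy 2).starProjection.comp (contToLp 2))
  have hpos : ∀ f : C(UnitAddCircle, ℂ), (∀ t, 0 ≤ (f t).re) →
      ‖T (reMap f)‖ ≤ C * ‖contToLp q (reMap f)‖ := by
    intro f hf
    have hcl : IsClosed {u : C(UnitAddCircle, ℂ) | ‖T u‖ ≤ C * ‖contToLp q u‖} :=
      isClosed_le (by fun_prop) (by fun_prop)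
    refine hcl.closure_subset (Metric.mem_closure_iff.2 fun ε hε => ?_)
    obtain ⟨P, hP0, hPm, hP⟩ := exists_circlePoly_near hf (ε := ε / 4) (by positivity)
    refine ⟨reMap (circlePoly P), norm_incl_starProjection_reMap_circlePoly_le hA hB h2 hAB
      (by positivity) hPm hP0, ?_⟩
    rw [dist_comm, dist_eq_norm]
    linarith
  -- The factor 4 counts the positive and negative parts of $\operatorname{Re}f$ and
  -- $\operatorname{Im}f$, each dominated by $|f|$.
  have hcont : ∀ f : C(UnitAddCircle, ℂ), ‖T f‖ ≤ 4 * C * ‖contToLp q f‖ := by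
    intro f
    have hpart : ∀ (φ : ℂ → ℝ) (hφ : Continuous φ), (∀ w, 0 ≤ φ w ∧ φ w ≤ ‖w‖) →
        ‖T (reMap ⟨fun t => (φ (f t) : ℂ), by fun_prop⟩)‖ ≤ C * ‖contToLp q f‖ := by
      intro φ hφ h
      refine (hpos _ fun t => ?_).trans ?_
      · exact (h (f t)).1
      · gcongr
        refine Lp.norm_le_norm_of_ae_le ?_
        filter_upwards [coeFn_contToLp q f, coeFn_contToLp q (reMap
          ⟨fun t => (φ (f t) : ℂ), by fun_prop⟩)] with t e1 e2
        rw [e1, e2]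
        change ‖(((φ (f t) : ℂ).re : ℝ) : ℂ)‖ ≤ _
        rw [Complex.ofReal_re, Complex.norm_real, Real.norm_of_nonneg (h _).1]
        exact (h _).2
    have p1 := hpart (fun w => max w.re 0) (by fun_prop) fun w =>
      ⟨le_max_right _ _, max_le (Complex.re_le_norm w) (norm_nonneg w)⟩
    have p2 := hpart (fun w => max (-w.re) 0) (by fun_prop) fun w =>
      ⟨le_max_right _ _, max_le ((neg_le_abs _).trans (Complex.abs_re_le_norm w)) (norm_nonneg w)⟩
    have p3 := hpart (fun w => max w.im 0) (by fun_prop) fun w =>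
      ⟨le_max_right _ _, max_le (Complex.im_le_norm w) (norm_nonneg w)⟩
    have p4 := hpart (fun w => max (-w.im) 0) (by fun_prop) fun w =>
      ⟨le_max_right _ _, max_le ((neg_le_abs _).trans (Complex.abs_im_le_norm w)) (norm_nonneg w)⟩
    set f1 := reMap ⟨fun t => ((max (f t).re 0 : ℝ) : ℂ), by fun_prop⟩
    set f2 := reMap ⟨fun t => ((max (-(f t).re) 0 : ℝ) : ℂ), by fun_prop⟩
    set f3 := reMap ⟨fun t => ((max (f t).im 0 : ℝ) : ℂ), by fun_prop⟩
    set f4 := reMap ⟨fun t => ((max (-(f t).im) 0 : ℝ) : ℂ), by fun_prop⟩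
    have hsplit : f = (f1 - f2) + Complex.I • (f3 - f4) := by
      have hmax : ∀ x : ℝ, x = max x 0 - max (-x) 0 := fun x => by
        rcases le_total 0 x with h | h <;> simp [h]
      ext t
      change f t = (((max (f t).re 0 : ℝ) : ℂ) - ((max (-(f t).re) 0 : ℝ) : ℂ)) +
        Complex.I * (((max (f t).im 0 : ℝ) : ℂ) - ((max (-(f t).im) 0 : ℝ) : ℂ))
      rw [← Complex.ofReal_sub, ← Complex.ofReal_sub, ← hmax, ← hmax, mul_comm,
        Complex.re_add_im]
    calc ‖T f‖ = ‖(T f1 - T f2) + Complex.I • (T f3 - T f4)‖ := by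
          rw [← map_sub, ← map_sub, ← map_smul, ← map_add, ← hsplit]
      _ ≤ (‖T f1‖ + ‖T f2‖) + 1 * (‖T f3‖ + ‖T f4‖) := by
          refine (norm_add_le _ _).trans (add_le_add (norm_sub_le _ _) ?_)
          rw [norm_smul, Complex.norm_I]
          gcongr
          exact norm_sub_le _ _
      _ ≤ _ := by linarith
  refine ⟨4 * C, fun f => ?_⟩
  have hcl : IsClosed {f : LpCircle 2 |
      ‖inclL h2 ((hardy 2).starProjection f)‖ ≤ 4 * C * ‖inclL h2 f‖} :=
    isClosed_le (by fun_prop) (by fun_prop)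
  have hdense := ContinuousMap.toLp_denseRange (p := 2) ℂ circleMeasure ℂ (by simp)
  exact hdense.induction_on f hcl hcont

/-- The M. Riesz theorem on the boundedness of the analytic projection in `L^q`, `1 < q ≤ 2`. -/
theorem exists_analyticProjection (h1 : 1 < q) (h2 : q ≤ 2) :
    ∃ R : LpCircle q →L[ℂ] LpCircle q, ∀ f k,
      coeff q k (R f) = if 0 ≤ k then coeff q k f else 0 := by
  have hq' : q ≠ ∞ := (h2.trans_lt (by simp)).ne
  obtain ⟨C, hC⟩ := exists_norm_incl_starProjection_le h1 h2
  have hdense : DenseRange (inclL h2) := by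
    refine (ContinuousMap.toLp_denseRange (p := q) ℂ circleMeasure ℂ hq').mono ?_
    rintro _ ⟨f, rfl⟩
    exact ⟨contToLp 2 f, rfl⟩
  let S : LpCircle 2 →L[ℂ] LpCircle q := (inclL h2).comp (hardy 2).starProjection
  refine ⟨S.toLinearMap.extendOfNorm (inclL h2).toLinearMap, fun f k => ?_⟩
  refine hdense.induction_on f (isClosed_eq ?_ ?_) fun g => ?_
  · exact ((coeffL q k).comp _).continuous
  · split_ifs
    · exact (coeffL q k).continuous
    · exact continuous_const
  · have := LinearMap.extendOfNorm_eq (f := S.toLinearMap) (e := (inclL h2).toLinearMap) hdense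
      ⟨C, hC⟩ g
    rw [ContinuousLinearMap.coe_coe] at this
    rw [this]
    exact coeff_starProjection_hardy g k

lemma span_fourierLp_dense (hq' : q ≠ ∞) :
    Dense (Submodule.span ℂ (Set.range (fourierLp (T := 1) q)) : Set (LpCircle q)) :=
  (Submodule.dense_iff_topologicalClosure_eq_top).2 (span_fourierLp_closure_eq_top hq')

end RieszProjection

/-! ### Products with bounded functions -/

section Products

lemma mulLp_fourierLp {r : ℝ≥0∞} [Fact (1 ≤ r)] (f : LpCircle ∞) (j k : ℤ) :
    coeff r k (mulLp ∞ r r f (fourierLp r j)) = coeff ∞ (k - j) f := by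
  rw [← coeff_fourierLp_mul]
  refine coeff_congr ?_ k
  filter_upwards [coeFn_mulLp ∞ r r f (fourierLp r j), coeFn_mulLp ∞ ∞ ∞ (fourierLp ∞ j) f,
    coeFn_fourierLp ∞ j, coeFn_fourierLp r j] with t h1 h2 h3 h4
  rw [h1, h2, h3, h4, mul_comm]

lemma star_mulLp_star {r : ℝ≥0∞} (f : LpCircle ∞) (g : LpCircle r) :
    star (mulLp ∞ r r (star f) g) = mulLp ∞ r r f (star g) := by
  apply Lp.ext
  filter_upwards [coeFn_mulLp ∞ r r f (star g), coeFn_mulLp ∞ r r (star f) g, Lp.coeFn_star f,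
    Lp.coeFn_star g, Lp.coeFn_star (mulLp ∞ r r (star f) g)] with t h1 h2 h3 h4 h5
  rw [h1, h5, Pi.star_apply, h2, h3, h4]
  simp

lemma star_fourierLp {r : ℝ≥0∞} [Fact (1 ≤ r)] (k : ℤ) :
    star (fourierLp (T := 1) r k) = fourierLp r (-k) := by
  apply Lp.ext
  filter_upwards [Lp.coeFn_star (fourierLp (T := 1) r k), coeFn_fourierLp r k,
    coeFn_fourierLp r (-k)] with t h1 h2 h3
  rw [h1, h3, Pi.star_apply, h2, fourier_neg]
  rfl

lemma continuous_mulLp (p r q : ℝ≥0∞) [Fact (1 ≤ p)] [Fact (1 ≤ r)] [Fact (1 ≤ q)]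
    [ENNReal.HolderTriple p r q] (a : LpCircle p) : Continuous (mulLp p r q a) :=
  ((ContinuousLinearMap.mul ℂ ℂ).holderL circleMeasure p r q a).continuous

/-- The identity is immediate for $g=z^j$ with $j\ge0$. Composing both sides with the projection
$R$, which fixes $g$, gives continuous functionals on all of $L^q$, so they need only be compared on
the dense span of the $z^j$, $j\in\mathbb Z$. -/
lemma coeff_zero_mulLp {q : ℝ≥0∞} [Fact (1 ≤ q)] (h1 : 1 < q) (h2 : q ≤ 2)
    {f : LpCircle ∞} {g : LpCircle q} (hf : f ∈ hardy ∞) (hg : g ∈ hardy q) :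
    coeff q 0 (mulLp ∞ q q f g) = coeff ∞ 0 f * coeff q 0 g := by
  obtain ⟨R, hR⟩ := exists_analyticProjection h1 h2
  have hRe : ∀ j, R (fourierLp q j) = if 0 ≤ j then fourierLp q j else 0 := fun j => by
    refine ext_coeff fun k => ?_
    rw [hR]
    split_ifs with hk hj hj
    · rfl
    · rw [coeff_fourierLp, if_neg (by lia), map_zero]
    · rw [coeff_fourierLp, if_neg (by lia)]
    · rw [map_zero]
  have hRg : R g = g := ext_coeff fun k => by
    rw [hR]
    split_ifs with hk
    · rfl
    · exact (hg k (not_le.1 hk)).symm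
  let Λ₁ : LpCircle q →L[ℂ] ℂ :=
    (coeffL q 0).comp (((ContinuousLinearMap.mul ℂ ℂ).holderL circleMeasure ∞ q q f).comp R)
  let Λ₂ : LpCircle q →L[ℂ] ℂ := coeff ∞ 0 f • (coeffL q 0).comp R
  have hΛ : Λ₁ = Λ₂ := by
    refine ContinuousLinearMap.ext_on (span_fourierLp_dense (h2.trans_lt (by simp)).ne) ?_
    rintro _ ⟨j, rfl⟩
    change coeff q 0 (mulLp ∞ q q f (R (fourierLp q j))) =
      coeff ∞ 0 f * coeff q 0 (R (fourierLp q j))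
    rw [hRe]
    split_ifs with hj
    · rw [mulLp_fourierLp, coeff_fourierLp]
      rcases hj.eq_or_lt with rfl | hj
      · simp
      · rw [hf _ (by lia), if_neg hj.ne, mul_zero]
    · simp
  have := congrArg (fun φ : LpCircle q →L[ℂ] ℂ => φ g) hΛ
  change coeff q 0 (mulLp ∞ q q f (R g)) = coeff ∞ 0 f * coeff q 0 (R g) at this
  rwa [hRg] at this

end Products

/-! ### The duality pairing of $(L^\infty)^n$ and $(L^r)^n$ -/

section Pairing

variable {n : ℕ} {r : ℝ≥0∞} [Fact (1 ≤ r)]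

/-- The sesquilinear pairing `∑ i, ∫ conj (h i) * u i` of `h ∈ (L^∞)^n` and `u ∈ (L^r)^n`. -/
noncomputable def pair (r : ℝ≥0∞) [Fact (1 ≤ r)] (h : LpVec ∞ n) (u : LpVec r n) : ℂ :=
  ∑ i, coeff r 0 (mulLp ∞ r r (star (h i)) (u i))

lemma pair_eq_integral (h : LpVec ∞ n) (u : LpVec r n) :
    pair r h u = ∫ t, ∑ i, star (h i t) * u i t ∂circleMeasure := by
  have hae : ∀ i, (mulLp ∞ r r (star (h i)) (u i) : UnitAddCircle → ℂ) =ᵐ[circleMeasure]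
      fun t => star (h i t) * u i t := fun i => by
    filter_upwards [coeFn_mulLp ∞ r r (star (h i)) (u i), Lp.coeFn_star (h i)] with t h1 h2
    rw [h1, h2, Pi.star_apply]
  rw [integral_finsetSum]
  · refine Finset.sum_congr rfl fun i _ => ?_
    rw [coeff_eq_integral]
    refine integral_congr_ae ?_
    filter_upwards [hae i] with t ht
    rw [ht, neg_zero, fourier_zero, one_mul]
  · exact fun i _ => (integrable_Lp _).congr (hae i)

lemma pair_add_left (h₁ h₂ : LpVec ∞ n) (u : LpVec r n) :
    pair r (h₁ + h₂) u = pair r h₁ u + pair r h₂ u := by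
  simp only [pair, PiLp.add_apply, star_add_Lp, map_add, LinearMap.add_apply,
    Finset.sum_add_distrib]

lemma pair_sub_right (h : LpVec ∞ n) (u v : LpVec r n) :
    pair r h (u - v) = pair r h u - pair r h v := by
  simp only [pair, PiLp.sub_apply, map_sub, Finset.sum_sub_distrib]

lemma continuous_pair (h : LpVec ∞ n) : Continuous (pair r h) :=
  continuous_finsetSum _ fun i _ => (coeffL r 0).continuous.comp
    ((continuous_mulLp ∞ r r _).comp (PiLp.continuous_apply 2 _ i))

lemma pair_mul_left (Θ : InnerMatrix n) (h : LpVec ∞ n) (u : LpVec r n) :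
    pair r (Θ.mul ∞ h) u = pair r h (Θ.adjMul r u) := by
  rw [pair_eq_integral, pair_eq_integral]
  refine integral_congr_ae ?_
  filter_upwards [ae_all_iff.2 fun i => coeFn_matMul ∞ ∞ Θ.toMat h i,
    ae_all_iff.2 fun i => Θ.coeFn_adjMul r u i] with t h1 h2
  change ∑ i, star (matMul ∞ ∞ Θ.toMat h i t) * u i t = _
  simp only [h1, h2, star_sum, Finset.sum_mul, Finset.mul_sum, star_mul']
  rw [Finset.sum_comm]
  exact Finset.sum_congr rfl fun i _ => Finset.sum_congr rfl fun j _ => by ring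

lemma pair_mul_right (Θ : InnerMatrix n) (h : LpVec ∞ n) (u : LpVec r n) :
    pair r h (Θ.mul r u) = pair r (Θ.adjMul ∞ h) u := by
  conv_lhs => rw [← Θ.mul_adjMul ∞ h]
  rw [pair_mul_left, Θ.adjMul_mul]

lemma pair_eq_zero_of_conj_left (h1 : 1 < r) (h2 : r ≤ 2) {h : LpVec ∞ n} {u : LpVec r n}
    (hh : h ∈ conjHardyZeroVec ∞ n) (hu : u ∈ hardyVec r n) : pair r h u = 0 :=
  Finset.sum_eq_zero fun i _ => by
    rw [coeff_zero_mulLp h1 h2 (hh i).1 (hu i), (hh i).2, zero_mul]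

lemma pair_eq_zero_of_conj_right (h1 : 1 < r) (h2 : r ≤ 2) {h : LpVec ∞ n} {u : LpVec r n}
    (hh : h ∈ hardyVec ∞ n) (hu : u ∈ conjHardyZeroVec r n) : pair r h u = 0 :=
  Finset.sum_eq_zero fun i _ => by
    -- The conjugate of the integrand is $h_i\overline{u_i}$, a product of Hardy functions whose
    -- second factor vanishes at $0$.
    have h3 := coeff_star 0 (mulLp ∞ r r (star (h i)) (u i))
    rw [star_mulLp_star, coeff_zero_mulLp h1 h2 (hh i) (hu i).1, (hu i).2, mul_zero, neg_zero] at h3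
    exact star_eq_zero.1 h3.symm

/-- The vector function `z ^ k e_j`. -/
noncomputable def monomialVec (n : ℕ) (k : ℤ) (j : Fin n) : LpVec ∞ n :=
  WithLp.toLp 2 (Pi.single j (fourierLp ∞ k))

lemma pair_monomialVec (k : ℤ) (j : Fin n) (u : LpVec r n) :
    pair r (monomialVec n k j) u = coeff r k (u j) := by
  rw [pair, Finset.sum_eq_single j]
  · change coeff r 0 (mulLp ∞ r r (star (Pi.single j (fourierLp ∞ k) : Fin n → LpCircle ∞) j) _) = _
    rw [Pi.star_apply, Pi.single_eq_same, star_fourierLp, coeff_fourierLp_mul, zero_sub, neg_neg]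
  · intro i _ hi
    change coeff r 0 (mulLp ∞ r r (star (Pi.single j (fourierLp ∞ k) : Fin n → LpCircle ∞) i) _) = _
    rw [Pi.star_apply, Pi.single_eq_of_ne hi, star_zero_Lp]
    simp
  · simp

lemma inner_inclVec_eq_pair (h : LpVec ∞ n) (u : LpVec 2 n) :
    inner ℂ (inclVec le_top n h) u = pair 2 h u := by
  rw [PiLp.inner_apply, pair]
  refine Finset.sum_congr rfl fun i _ => ?_
  rw [L2.inner_def, coeff_eq_integral]
  refine integral_congr_ae ?_
  filter_upwards [coeFn_mulLp ∞ 2 2 (star (h i)) (u i), Lp.coeFn_star (h i)] with t h1 h2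
  rw [h1, h2, neg_zero, fourier_zero, one_mul, RCLike.inner_apply, mul_comm]
  rfl

end Pairing

/-! ### Bounded test functions in the model space -/

section MultiplicationOperators

variable {n : ℕ}

lemma continuous_matMul_of_holderTriple {p : ℝ≥0∞} (r q : ℝ≥0∞) [Fact (1 ≤ p)] [Fact (1 ≤ r)]
    [Fact (1 ≤ q)] [ENNReal.HolderTriple p r q] (A : LpMat p n) : Continuous (matMul r q A) := by
  refine (PiLp.continuous_toLp 2 _).comp (continuous_pi fun i => ?_)
  have h : Continuous fun f : LpVec r n => (∑ j, mulLp p r q (A i j) (f j) : LpCircle q) :=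
    continuous_finsetSum Finset.univ fun j _ =>
      (continuous_mulLp p r q (A i j)).comp (PiLp.continuous_apply 2 _ j)
  exact h

/-- Multiplication by a bounded matrix function commutes with the inclusions between the `L^r` spaces. -/
lemma matMul_inclVec {q r : ℝ≥0∞} (h : q ≤ r) (A : LpMat ∞ n) (f : LpVec r n) :
    matMul q q A (inclVec h n f) = inclVec h n (matMul r r A f) := by
  ext1 i
  apply Lp.ext
  filter_upwards [coeFn_matMul q q A (inclVec h n f) i, coeFn_matMul r r A f i] with t h1 h2
  exact h1.trans h2.symm

lemma inclVec_mem_hardyVec_iff {q r : ℝ≥0∞} [Fact (1 ≤ q)] [Fact (1 ≤ r)] (h : q ≤ r)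
    {f : LpVec r n} : inclVec h n f ∈ hardyVec q n ↔ f ∈ hardyVec r n := Iff.rfl

lemma inclVec_mem_conjHardyZeroVec_iff {q r : ℝ≥0∞} [Fact (1 ≤ q)] [Fact (1 ≤ r)] (h : q ≤ r)
    {f : LpVec r n} : inclVec h n f ∈ conjHardyZeroVec q n ↔ f ∈ conjHardyZeroVec r n := by
  rw [mem_conjHardyZeroVec, mem_conjHardyZeroVec]
  exact Iff.rfl

variable (Θ : InnerMatrix n)

lemma mem_modelSpace {f : LpVec 2 n} :
    f ∈ Θ.modelSpace ↔ Θ.adjMul 2 f ∈ conjHardyZeroVec 2 n ∧ f ∈ hardyVec 2 n := by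
  refine and_congr_left fun _ => ⟨?_, fun hf => ⟨_, hf, Θ.mul_adjMul 2 f⟩⟩
  rintro ⟨g, hg, rfl⟩
  rwa [Θ.adjMul_mul]

lemma mem_boundedModel {h : LpVec ∞ n} :
    h ∈ boundedModel Θ ↔ Θ.adjMul ∞ h ∈ conjHardyZeroVec ∞ n ∧ h ∈ hardyVec ∞ n := by
  rw [boundedModel, Submodule.mem_inf, Submodule.mem_comap, mem_modelSpace,
    inclVec_mem_hardyVec_iff, InnerMatrix.adjMul, matMul_inclVec, inclVec_mem_conjHardyZeroVec_iff]
  exact ⟨fun h => h.2, fun h => ⟨h.2, h⟩⟩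

/-- The analytic part of the (co-analytic times `z ^ k`) vector function `Θ^* z ^ k e_j`. -/
noncomputable def analyticPart (k : ℕ) (j : Fin n) : LpVec ∞ n :=
  WithLp.toLp 2 fun i => ∑ l ∈ Finset.range (k + 1),
    coeff ∞ l (Θ.adjMul ∞ (monomialVec n k j) i) • fourierLp ∞ (l : ℤ)

lemma coeff_analyticPart (k : ℕ) (j i : Fin n) (m : ℤ) :
    coeff ∞ m (analyticPart Θ k j i) =
      if 0 ≤ m ∧ m ≤ k then coeff ∞ m (Θ.adjMul ∞ (monomialVec n k j) i) else 0 := by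
  have h1 : coeff ∞ m (analyticPart Θ k j i) = ∑ l ∈ Finset.range (k + 1),
      if m = l then coeff ∞ l (Θ.adjMul ∞ (monomialVec n k j) i) else 0 := by
    change coeff ∞ m (∑ l ∈ Finset.range (k + 1), _) = _
    simp only [map_sum, map_smul, coeff_fourierLp, smul_eq_mul, mul_ite, mul_one, mul_zero]
  rw [h1]
  split_ifs with hm
  · obtain ⟨hm0, hmk⟩ := hm
    lift m to ℕ using hm0
    rw [Finset.sum_eq_single m]
    · simp
    · intro l _ hl
      rw [if_neg (by lia)]
    · intro hm
      exact absurd (Finset.mem_range.2 (by lia)) hm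
  · refine Finset.sum_eq_zero fun l hl => if_neg ?_
    have := Finset.mem_range.1 hl
    lia

lemma adjMul_monomialVec (k : ℤ) (i j : Fin n) :
    Θ.adjMul ∞ (monomialVec n k j) i = mulLp ∞ ∞ ∞ (star (Θ.toMat j i)) (fourierLp ∞ k) := by
  change ∑ l, mulLp ∞ ∞ ∞ (star (Θ.toMat l i)) ((Pi.single j (fourierLp ∞ k) : Fin n → _) l) = _
  rw [Finset.sum_eq_single j]
  · rw [Pi.single_eq_same]
  · intro l _ hl
    rw [Pi.single_eq_of_ne hl, map_zero]
  · simp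

/-- $\Theta^*z^ke_j$ has no frequency above $k$, so its analytic part is a polynomial. Hence
everything stays in $L^\infty$, although the Riesz projection is unbounded there. -/
lemma adjMul_monomialVec_sub_analyticPart_mem (k : ℕ) (j : Fin n) :
    Θ.adjMul ∞ (monomialVec n k j) - analyticPart Θ k j ∈ conjHardyZeroVec ∞ n := by
  rw [mem_conjHardyZeroVec]
  intro i m hm
  rw [PiLp.sub_apply, map_sub, coeff_analyticPart]
  split_ifs with h
  · exact sub_self _
  · rw [adjMul_monomialVec, mulLp_fourierLp, coeff_star, Θ.mem_hardy j i _ (by lia)]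
    simp

lemma analyticPart_mem_hardyVec (k : ℕ) (j : Fin n) : analyticPart Θ k j ∈ hardyVec ∞ n :=
  fun i m hm => by rw [coeff_analyticPart, if_neg (by lia)]

lemma mul_analyticPart_mem_hardyVec (k : ℕ) (j : Fin n) :
    Θ.mul ∞ (analyticPart Θ k j) ∈ hardyVec ∞ n := by
  intro i
  change ∑ l, mulLp ∞ ∞ ∞ (Θ.toMat i l) (∑ a ∈ Finset.range (k + 1), _) ∈ hardy ∞
  refine Submodule.sum_mem _ fun l _ => ?_
  rw [map_sum]
  refine Submodule.sum_mem _ fun a _ => ?_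
  rw [map_smul]
  refine Submodule.smul_mem _ _ fun m hm => ?_
  rw [mulLp_fourierLp]
  exact Θ.mem_hardy i l _ (by lia)

lemma monomialVec_mem_hardyVec (k : ℕ) (j : Fin n) : monomialVec n k j ∈ hardyVec ∞ n := by
  intro i
  change (Pi.single j (fourierLp ∞ (k : ℤ)) : Fin n → LpCircle ∞) i ∈ hardy ∞
  by_cases h : i = j
  · subst h
    rw [Pi.single_eq_same]
    exact fourierLp_mem_hardy ∞ (by lia)
  · rw [Pi.single_eq_of_ne h]
    exact zero_mem _

/-- The bounded function `P_Θ (z ^ k e_j)` of the model space. -/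
noncomputable def modelVec (k : ℕ) (j : Fin n) : boundedModel Θ :=
  ⟨monomialVec n k j - Θ.mul ∞ (analyticPart Θ k j), by
    rw [mem_boundedModel, map_sub, Θ.adjMul_mul]
    exact ⟨adjMul_monomialVec_sub_analyticPart_mem Θ k j,
      sub_mem (monomialVec_mem_hardyVec k j) (mul_analyticPart_mem_hardyVec Θ k j)⟩⟩

/-- Split $z^ke_j$ into its model-space part and $\Theta$ times an analytic polynomial, then move
$\Theta$ across the pairing. Nonnegative Fourier coefficients can thus be read off from test
functions in $K_\Theta\cap(H^\infty)^n$ and from $\Theta^*u$. -/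
lemma coeff_eq_pair_modelVec_add {r : ℝ≥0∞} [Fact (1 ≤ r)] (k : ℕ) (j : Fin n) (u : LpVec r n) :
    coeff r k (u j) =
      pair r (modelVec Θ k j : LpVec ∞ n) u + pair r (analyticPart Θ k j) (Θ.adjMul r u) := by
  rw [← pair_mul_left, ← pair_add_left, ← pair_monomialVec]
  congr 1
  exact (sub_add_cancel _ _).symm

lemma coe_boundedModelIncl (h : boundedModel Θ) :
    (boundedModelIncl Θ h : LpVec 2 n) = inclVec le_top n (h : LpVec ∞ n) := rfl

lemma denseRange_boundedModelIncl : DenseRange (boundedModelIncl Θ) := by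
  have h : (LinearMap.range (boundedModelIncl Θ))ᗮ = ⊥ := by
    rw [Submodule.eq_bot_iff]
    intro u hu
    obtain ⟨hu1, hu2⟩ := (mem_modelSpace Θ).1 u.2
    apply Subtype.ext
    ext1 j
    refine eq_zero_of_coeff_eq_zero fun k => ?_
    rcases lt_or_ge k 0 with hk | hk
    · exact hu2 j k hk
    · lift k to ℕ using hk
      -- The second term vanishes because $\Theta^*u$ is co-analytic, the first because $u$ is
      -- orthogonal to the bounded functions.
      rw [coeff_eq_pair_modelVec_add Θ,
        pair_eq_zero_of_conj_right (by norm_num) le_rfl (analyticPart_mem_hardyVec Θ k j) hu1,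
        add_zero, ← inner_inclVec_eq_pair]
      have h0 := (Submodule.mem_orthogonal _ _).1 hu _ (LinearMap.mem_range_self _ (modelVec Θ k j))
      rwa [Submodule.coe_inner, coe_boundedModelIncl] at h0
  rw [DenseRange, ← LinearMap.coe_range, Submodule.dense_iff_topologicalClosure_eq_top,
    Submodule.topologicalClosure_eq_top_iff]
  exact h

end MultiplicationOperators

/-! ### The kernel of $A_G^\Theta$ as a projected Toeplitz kernel -/

section Kernel

lemma one_lt_of_holderTriple {p q : ℝ≥0∞} [ENNReal.HolderTriple p 2 q] (hp : 2 < p) : 1 < q := by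
  have h := ENNReal.HolderTriple.inv_add_inv_eq_inv p 2 q
  rw [← ENNReal.inv_lt_one, ← h]
  have h2 : p⁻¹ < 2⁻¹ := ENNReal.inv_lt_inv.2 hp
  calc p⁻¹ + 2⁻¹ < 2⁻¹ + 2⁻¹ := ENNReal.add_lt_add_right (by simp) h2
    _ = 1 := ENNReal.inv_two_add_inv_two

lemma le_two_of_holderTriple (p q : ℝ≥0∞) [ENNReal.HolderTriple p 2 q] : q ≤ 2 := by
  have h := ENNReal.HolderTriple.inv_add_inv_eq_inv p 2 q
  rw [← ENNReal.inv_le_inv, ← h]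
  exact le_add_self

variable {n : ℕ} (Θ : InnerMatrix n)

lemma matMul_inclMat {p q : ℝ≥0∞} [ENNReal.HolderTriple p 2 q] [Fact (1 ≤ q)] (h2p : 2 ≤ p)
    (G : LpMat p n) (h f : LpVec ∞ n) :
    pair 2 h (matMul ∞ 2 (inclMat h2p G) f) = pair q h (matMul 2 q G (inclVec le_top n f)) := by
  rw [pair_eq_integral, pair_eq_integral]
  refine integral_congr_ae ?_
  filter_upwards [ae_all_iff.2 fun i => coeFn_matMul ∞ 2 (inclMat h2p G) f i,
    ae_all_iff.2 fun i => coeFn_matMul 2 q G (inclVec le_top n f) i] with t h1 h2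
  refine Finset.sum_congr rfl fun i _ => ?_
  rw [h1, h2]
  rfl

/-- For unbounded $f\in K_\Theta$ the product $Gf$ is only known to lie in $L^q$, so $P_\Theta(Gf)$
need not make sense. Its weak form does: both sides are continuous in $f$ and agree on the dense
subspace of bounded functions. -/
lemma inner_mtto {p q : ℝ≥0∞} [ENNReal.HolderTriple p 2 q] [Fact (1 ≤ q)] (h2p : 2 ≤ p)
    (G : LpMat p n) (hG : IsMTTO Θ (inclMat h2p G)) (h : boundedModel Θ) (f : Θ.modelSpace) :
    inner ℂ (boundedModelIncl Θ h) (mtto Θ (inclMat h2p G) f) =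
      pair q (h : LpVec ∞ n) (matMul 2 q G f) := by
  have : Fact (1 ≤ p) := ⟨le_trans (by norm_num) h2p⟩
  refine (denseRange_boundedModelIncl Θ).induction_on
    (p := fun f : Θ.modelSpace => inner ℂ (boundedModelIncl Θ h) (mtto Θ (inclMat h2p G) f) =
      pair q (h : LpVec ∞ n) (matMul 2 q G f)) f 
    (isClosed_eq (continuous_const.inner (mtto Θ (inclMat h2p G)).continuous) ?_) fun g => ?_
  · exact (continuous_pair _).comp
      ((continuous_matMul_of_holderTriple 2 q G).comp continuous_subtype_val)
  · rw [mtto, LinearMap.extendOfNorm_eq (denseRange_boundedModelIncl Θ) hG, coe_boundedModelIncl,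
      ← matMul_inclMat h2p, ← inner_inclVec_eq_pair]
    exact Submodule.inner_orthogonalProjectionOnto_eq_of_mem_left _ _

lemma mtto_eq_zero_iff {p q : ℝ≥0∞} [ENNReal.HolderTriple p 2 q] [Fact (1 ≤ q)] (h2p : 2 ≤ p)
    (G : LpMat p n) (hG : IsMTTO Θ (inclMat h2p G)) (f : Θ.modelSpace) :
    mtto Θ (inclMat h2p G) f = 0 ↔
      ∀ h : boundedModel Θ, pair q (h : LpVec ∞ n) (matMul 2 q G f) = 0 := by
  constructor
  · intro h0 h
    rw [← inner_mtto Θ h2p G hG, h0, inner_zero_right]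
  · intro h0
    refine (denseRange_boundedModelIncl Θ).eq_zero_of_inner_right ℂ ?_
    intro h
    rw [inner_mtto Θ h2p G hG (q := q), h0]

/-- The candidate is $u=-w$, with $w$ the analytic part of $\Theta^*g$. Conversely, a test function
$h$ is analytic with $\Theta^*h$ co-analytic, so it annihilates both $\overline{H^q_0}$ and $\Theta
H^q$. -/
lemma forall_pair_eq_zero_iff {q : ℝ≥0∞} [Fact (1 ≤ q)] (h1 : 1 < q) (h2 : q ≤ 2)
    (g : LpVec q n) :
    (∀ h : boundedModel Θ, pair q (h : LpVec ∞ n) g = 0) ↔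
      ∃ u ∈ hardyVec q n, g + Θ.mul q u ∈ conjHardyZeroVec q n := by
  constructor
  · intro h0
    obtain ⟨R, hR⟩ := exists_analyticProjection h1 h2
    let w : LpVec q n := WithLp.toLp 2 fun i => R (Θ.adjMul q g i)
    have hw : w ∈ hardyVec q n := fun i k hk => by
      change coeff q k (R _) = 0
      rw [hR, if_neg (not_le.2 hk)]
    have hgw : Θ.adjMul q g - w ∈ conjHardyZeroVec q n := by
      rw [mem_conjHardyZeroVec]
      intro i k hk
      change coeff q k (Θ.adjMul q g i - R (Θ.adjMul q g i)) = 0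
      rw [map_sub, hR, if_pos hk, sub_self]
    refine ⟨-w, neg_mem hw, ?_⟩
    rw [map_neg, ← sub_eq_add_neg, mem_conjHardyZeroVec]
    intro j k hk
    lift k to ℕ using hk
    -- The test function kills $g$ by hypothesis and $\Theta w$ because $w$ is analytic; the
    -- remaining term pairs an analytic polynomial with the co-analytic $\Theta^*g-w$.
    rw [coeff_eq_pair_modelVec_add Θ, pair_sub_right, h0, pair_mul_right,
      pair_eq_zero_of_conj_left h1 h2 ((mem_boundedModel Θ).1 (modelVec Θ k j).2).1 hw, map_sub,
      Θ.adjMul_mul, pair_eq_zero_of_conj_right h1 h2 (analyticPart_mem_hardyVec Θ k j) hgw]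
    simp
  · rintro ⟨u, hu, hgu⟩ h
    obtain ⟨hh1, hh2⟩ := (mem_boundedModel Θ).1 h.2
    rw [← add_sub_cancel_right g (Θ.mul q u), pair_sub_right, pair_mul_right,
      pair_eq_zero_of_conj_left h1 h2 hh1 hu, pair_eq_zero_of_conj_right h1 h2 hh2 hgu, sub_zero]

variable {p q : ℝ≥0∞} [ENNReal.HolderTriple p 2 q] [Fact (1 ≤ q)]

lemma mem_kerBlockToeplitz {G : LpMat p n} {F : hardyVec 2 n × hardyVec q n} :
    F ∈ kerBlockToeplitz q Θ G ↔ Θ.adjMul 2 F.1 ∈ conjHardyZeroVec 2 n ∧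
      matMul 2 q G F.1 + Θ.mul q F.2 ∈ conjHardyZeroVec q n := by
  rw [← rieszProj_eq_zero_iff, ← rieszProj_eq_zero_iff]
  exact Prod.ext_iff

/-- `ker T_𝒢` as a subspace. -/
def kerBlock (q : ℝ≥0∞) [ENNReal.HolderTriple p 2 q] [Fact (1 ≤ q)] (G : LpMat p n) :
    Submodule ℂ (hardyVec 2 n × hardyVec q n) where
  carrier := kerBlockToeplitz q Θ G
  zero_mem' := by
    rw [mem_kerBlockToeplitz]
    simp
  add_mem' {F F'} hF hF' := by
    rw [mem_kerBlockToeplitz] at hF hF' ⊢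
    have h1 := add_mem hF.1 hF'.1
    have h2 := add_mem hF.2 hF'.2
    rw [← map_add] at h1
    rw [add_add_add_comm, ← map_add, ← map_add] at h2
    exact ⟨h1, h2⟩
  smul_mem' c F hF := by
    rw [mem_kerBlockToeplitz] at hF ⊢
    have h1 := Submodule.smul_mem _ c hF.1
    have h2 := Submodule.smul_mem _ c hF.2
    rw [← map_smul] at h1
    rw [smul_add, ← map_smul, ← map_smul] at h2
    exact ⟨h1, h2⟩

lemma mem_kerMTTO_iff (hp : 2 < p) {G : LpMat p n} (hG : IsMTTO Θ (inclMat hp.le G))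
    {f : LpVec 2 n} :
    f ∈ kerMTTO Θ (inclMat hp.le G) ↔ ∃ F ∈ kerBlock Θ q G, (F.1 : LpVec 2 n) = f := by
  have h1 : 1 < q := one_lt_of_holderTriple hp
  have h2 := le_two_of_holderTriple p q
  constructor
  · rintro ⟨f, hf, rfl⟩
    obtain ⟨u, hu, hgu⟩ := (forall_pair_eq_zero_iff Θ h1 h2 _).1
      ((mtto_eq_zero_iff Θ hp.le G hG f).1 hf)
    obtain ⟨hf1, hf2⟩ := (mem_modelSpace Θ).1 f.2
    exact ⟨(⟨f, hf2⟩, ⟨u, hu⟩), (mem_kerBlockToeplitz Θ).2 ⟨hf1, hgu⟩, rfl⟩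
  · rintro ⟨F, hF, rfl⟩
    obtain ⟨hF1, hF2⟩ := (mem_kerBlockToeplitz Θ).1 hF
    refine ⟨⟨F.1, (mem_modelSpace Θ).2 ⟨hF1, F.1.2⟩⟩, ?_, rfl⟩
    exact (mtto_eq_zero_iff Θ hp.le G hG _).2
      ((forall_pair_eq_zero_iff Θ h1 h2 _).2 ⟨F.2, F.2.2, hF2⟩)

end Kernel

/-! ### Division by $z$ in the Toeplitz kernel -/

section Division

variable {n : ℕ}

/-- Division by the independent variable on `(L^r)^n`. -/
noncomputable def divVec (r : ℝ≥0∞) (n : ℕ) (f : LpVec r n) : LpVec r n :=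
  WithLp.toLp 2 fun i => mulLp ∞ r r (fourierLp ∞ (-1)) (f i)

lemma coeFn_divVec (r : ℝ≥0∞) (f : LpVec r n) (i : Fin n) :
    (divVec r n f i : UnitAddCircle → ℂ) =ᵐ[circleMeasure] fun t => fourier (-1) t * f i t := by
  filter_upwards [coeFn_mulLp ∞ r r (fourierLp ∞ (-1)) (f i), coeFn_fourierLp ∞ (-1)] with t h1 h2
  rw [← h2]
  exact h1

lemma coeff_divVec {r : ℝ≥0∞} [Fact (1 ≤ r)] (f : LpVec r n) (i : Fin n) (k : ℤ) :
    coeff r k (divVec r n f i) = coeff r (k + 1) (f i) := by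
  change coeff r k (mulLp ∞ r r (fourierLp ∞ (-1)) (f i)) = _
  rw [coeff_fourierLp_mul, sub_neg_eq_add]

lemma divVec_add {r : ℝ≥0∞} (f g : LpVec r n) :
    divVec r n (f + g) = divVec r n f + divVec r n g :=
  PiLp.ext fun i => map_add (mulLp ∞ r r (fourierLp ∞ (-1))) (f i) (g i)

lemma matMul_divVec {p : ℝ≥0∞} (r q : ℝ≥0∞) [ENNReal.HolderTriple p r q] (A : LpMat p n)
    (f : LpVec r n) : matMul r q A (divVec r n f) = divVec q n (matMul r q A f) := by
  ext1 i
  apply Lp.ext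
  filter_upwards [coeFn_matMul r q A (divVec r n f) i, coeFn_divVec q (matMul r q A f) i,
    coeFn_matMul r q A f i, ae_all_iff.2 fun j => coeFn_divVec r f j] with t h1 h2 h3 h4
  rw [h1, h2, h3, Finset.mul_sum]
  refine Finset.sum_congr rfl fun j _ => ?_
  rw [h4]
  ring

lemma divVec_mem_hardyVec_iff {r : ℝ≥0∞} [Fact (1 ≤ r)] {f : LpVec r n} (hf : f ∈ hardyVec r n) :
    divVec r n f ∈ hardyVec r n ↔ evalZero r n f = 0 := by
  constructor
  · intro h
    ext i
    have := h i (-1) (by norm_num)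
    rwa [coeff_divVec] at this
  · intro h i k hk
    rw [coeff_divVec]
    rcases lt_or_eq_of_le (Int.add_one_le_iff.2 hk) with h0 | h0
    · exact hf i _ h0
    · rw [h0]
      exact congrFun h i

lemma divVec_mem_conjHardyZeroVec {r : ℝ≥0∞} [Fact (1 ≤ r)] {f : LpVec r n}
    (hf : f ∈ conjHardyZeroVec r n) : divVec r n f ∈ conjHardyZeroVec r n := by
  rw [mem_conjHardyZeroVec] at hf ⊢
  intro i k hk
  rw [coeff_divVec]
  exact hf i _ (by lia)

lemma backwardShift_of_evalZero_eq_zero {f : LpVec 2 n} (hf : evalZero 2 n f = 0) :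
    backwardShift f = divZ n f := by
  have h : constVec (0 : Fin n → ℂ) = 0 := PiLp.ext fun i => zero_smul ℂ _
  rw [backwardShift, hf, h, sub_zero]

/-- Multiplication by $\bar z$ commutes with $\Theta^*$, $G$ and $\Theta$ and preserves
$\overline{H_0}$. Vanishing at $0$ is needed only to keep both components analytic. -/
lemma exists_div_mem_kerBlock (Θ : InnerMatrix n) {p q : ℝ≥0∞} [ENNReal.HolderTriple p 2 q]
    [Fact (1 ≤ q)] {G : LpMat p n} {F : hardyVec 2 n × hardyVec q n} (hF : F ∈ kerBlock Θ q G)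
    (h0 : evalZeroPair q n F = 0) : ∃ F' ∈ kerBlock Θ q G, (F'.1 : LpVec 2 n) = divZ n F.1 := by
  obtain ⟨hF1, hF2⟩ := (mem_kerBlockToeplitz Θ).1 hF
  have e1 : evalZero 2 n F.1 = 0 := congrArg Prod.fst h0
  have e2 : evalZero q n F.2 = 0 := congrArg Prod.snd h0
  refine ⟨(⟨divVec 2 n F.1, (divVec_mem_hardyVec_iff F.1.2).2 e1⟩,
    ⟨divVec q n F.2, (divVec_mem_hardyVec_iff F.2.2).2 e2⟩), ?_, rfl⟩
  refine (mem_kerBlockToeplitz Θ).2 ⟨?_, ?_⟩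
  · change matMul 2 2 Θ.toMat.conjTranspose (divVec 2 n F.1) ∈ _
    rw [matMul_divVec]
    exact divVec_mem_conjHardyZeroVec hF1
  · change matMul 2 q G (divVec 2 n F.1) + matMul q q Θ.toMat (divVec q n F.2) ∈ _
    rw [matMul_divVec, matMul_divVec, ← divVec_add]
    exact divVec_mem_conjHardyZeroVec hF2

end Division

/-! ### The defect space and its dimension -/

section Defect

variable {n : ℕ}

lemma explicitDefect_le_map {q : ℝ≥0∞} [Fact (1 ≤ q)] {r : ℕ}
    (W : Fin r → hardyVec 2 n × hardyVec q n) :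
    explicitDefect W ≤ (LinearMap.ker (Fintype.linearCombination ℂ
      fun i => evalZero 2 n (W i).1)).map
        (divZ n ∘ₗ Fintype.linearCombination ℂ fun i => ((W i).1 : LpVec 2 n)) := by
  rintro _ ⟨⟨f, hf, rfl⟩, hD⟩
  have hfH : f ∈ hardyVec 2 n := by
    refine Submodule.span_le.2 ?_ hf
    rintro _ ⟨i, rfl⟩
    exact (W i).1.2
  have hf0 := (divVec_mem_hardyVec_iff hfH).1 hD
  rw [SetLike.mem_coe, ← Fintype.range_linearCombination] at hf
  obtain ⟨a, rfl⟩ := hf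
  refine ⟨a, ?_, rfl⟩
  rw [SetLike.mem_coe, LinearMap.mem_ker, ← hf0]
  simp only [Fintype.linearCombination_apply, map_sum, map_smul]

/-- Where the combination of the $u_i$ vanishes, independence of the pairs makes the combination of
the $v_i$ injective into $\mathbb C^n$. -/
lemma finrank_ker_le {r : ℕ} {u v : Fin r → Fin n → ℂ}
    (huv : LinearIndependent ℂ fun i => (u i, v i)) :
    Module.finrank ℂ (LinearMap.ker (Fintype.linearCombination ℂ u)) ≤ n := by
  let φ := (Fintype.linearCombination ℂ v) ∘ₗ
    (LinearMap.ker (Fintype.linearCombination ℂ u)).subtype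
  have hφ : Function.Injective φ := by
    rw [← LinearMap.ker_eq_bot, LinearMap.ker_eq_bot']
    intro a ha
    have ha1 := LinearMap.mem_ker.1 a.2
    apply Subtype.ext
    ext i
    refine Fintype.linearIndependent_iff.1 huv a ?_ i
    simp only [φ, LinearMap.comp_apply, Submodule.subtype_apply,
      Fintype.linearCombination_apply] at ha ha1
    simp only [Prod.smul_mk, Prod.ext_iff, Prod.fst_sum, Prod.snd_sum]
    exact ⟨ha1, ha⟩
  simpa using LinearMap.finrank_le_finrank_of_injective hφ

lemma finrank_explicitDefect_le {q : ℝ≥0∞} [Fact (1 ≤ q)] {r : ℕ}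
    {W : Fin r → hardyVec 2 n × hardyVec q n}
    (hW : LinearIndependent ℂ fun i => evalZeroPair q n (W i)) :
    Module.finrank ℂ (explicitDefect W) ≤ n :=
  (Submodule.finrank_mono (explicitDefect_le_map W)).trans
    ((Submodule.finrank_map_le _ _).trans (finrank_ker_le hW))

variable (Θ : InnerMatrix n) {p q : ℝ≥0∞} [ENNReal.HolderTriple p 2 q] [Fact (1 ≤ q)]

lemma isDefectSpace_explicitDefect (hp : 2 < p) {G : LpMat p n} (hG : IsMTTO Θ (inclMat hp.le G))
    {r : ℕ} {W : Fin r → hardyVec 2 n × hardyVec q n} (hW : ∀ i, W i ∈ kerBlock Θ q G)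
    (hspan : ∀ F ∈ kerBlock Θ q G,
      evalZeroPair q n F ∈ Submodule.span ℂ (Set.range fun i => evalZeroPair q n (W i))) :
    IsDefectSpace (kerMTTO Θ (inclMat hp.le G)) (explicitDefect W) where
  le_hardy := inf_le_right
  finite := Submodule.finiteDimensional_of_le (explicitDefect_le_map W)
  backwardShift_mem f hf hf0 := by
    obtain ⟨F, hF, rfl⟩ := (mem_kerMTTO_iff Θ hp hG (q := q)).1 hf
    have hE := hspan F hF
    rw [← Fintype.range_linearCombination] at hE
    obtain ⟨a, ha⟩ := hE
    have hS : ∑ i, a i • W i ∈ kerBlock Θ q G :=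
      Submodule.sum_mem _ fun i _ => Submodule.smul_mem _ _ (hW i)
    obtain ⟨F', hF', hdiv⟩ := exists_div_mem_kerBlock Θ (sub_mem hF hS) (by
      rw [map_sub, ← ha, Fintype.linearCombination_apply, map_sum]
      simp only [map_smul, sub_self])
    have hF'M : (F'.1 : LpVec 2 n) ∈ kerMTTO Θ (inclMat hp.le G) :=
      (mem_kerMTTO_iff Θ hp hG (q := q)).2 ⟨F', hF', rfl⟩
    have hsum : (((∑ i, a i • W i).1 : hardyVec 2 n) : LpVec 2 n) =
        ∑ i, a i • ((W i).1 : LpVec 2 n) := by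
      rw [Prod.fst_sum, Submodule.coe_sum]
      rfl
    have hdiv' : (F'.1 : LpVec 2 n) =
        divZ n F.1 - divZ n (∑ i, a i • ((W i).1 : LpVec 2 n)) := by
      rw [hdiv, ← map_sub, ← hsum]
      rfl
    have hsplit : divZ n F.1 = F'.1 + divZ n (∑ i, a i • ((W i).1 : LpVec 2 n)) := by
      rw [hdiv', sub_add_cancel]
    rw [backwardShift_of_evalZero_eq_zero hf0, hsplit]
    refine Submodule.add_mem_sup hF'M ⟨⟨_, ?_, rfl⟩, ?_⟩
    · exact Submodule.sum_mem _ fun i _ => Submodule.smul_mem _ _ (Submodule.subset_span ⟨i, rfl⟩)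
    -- The single quotients $P_nW_i/z$ need not be analytic; their combination is, being the
    -- difference of $f/z$ and the first component of $F'$, both in $(H^2)^n$.
    · rw [← sub_eq_of_eq_add' hsplit]
      exact sub_mem ((divVec_mem_hardyVec_iff F.1.2).2 hf0) F'.1.2

lemma kerMTTO_le_hardyVec (G : LpMat 2 n) : kerMTTO Θ G ≤ hardyVec 2 n := by
  rintro _ ⟨f, _, rfl⟩
  exact f.2.2

lemma isClosed_kerMTTO (G : LpMat 2 n) : IsClosed (kerMTTO Θ G : Set (LpVec 2 n)) := by
  rw [kerMTTO, Submodule.map_coe]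
  exact Θ.isClosed_modelSpace.isClosedEmbedding_subtypeVal.isClosedMap _ (mtto Θ G).isClosed_ker

/-- Projecting a defect space onto the orthogonal complement of `M` gives an orthogonal defect
space. -/
lemma IsDefectSpace.exists_isNearlyInvariantWithDefect {M D : Submodule ℂ (LpVec 2 n)}
    (hD : IsDefectSpace M D) (hM : M ≤ hardyVec 2 n) (hcl : IsClosed (M : Set (LpVec 2 n))) :
    ∃ m ≤ Module.finrank ℂ D, IsNearlyInvariantWithDefect M m := by
  have : CompleteSpace M := hcl.isComplete.completeSpace_coe
  have := hD.finite
  let D' := D.map (Mᗮ.starProjection : LpVec 2 n →ₗ[ℂ] LpVec 2 n)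
  have hproj : ∀ d : LpVec 2 n, Mᗮ.starProjection d = d - M.starProjection d := fun d =>
    Submodule.starProjection_orthogonal_val d
  refine ⟨Module.finrank ℂ D', Submodule.finrank_map_le _ _, hM, hcl, D', ⟨?_, ?_, ?_⟩, ?_, rfl⟩
  · rintro _ ⟨d, hd, rfl⟩
    change Mᗮ.starProjection d ∈ _
    rw [hproj]
    exact sub_mem (hD.le_hardy hd) (hM (M.starProjection_apply_mem d))
  · infer_instance
  · intro f hf hf0
    -- Each $d\in D$ differs from its projection onto $M^\perp$ by an element of $M$.
    have hle : M ⊔ D ≤ M ⊔ D' := by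
      refine sup_le le_sup_left fun d hd => ?_
      have h := Submodule.add_mem_sup (M.starProjection_apply_mem d)
        (Submodule.mem_map_of_mem (f := (Mᗮ.starProjection : LpVec 2 n →ₗ[ℂ] LpVec 2 n)) hd)
      have e : M.starProjection d + Mᗮ.starProjection d = d := by rw [hproj, add_sub_cancel]
      rw [ContinuousLinearMap.coe_coe, e] at h
      exact h
    exact hle (hD.backwardShift_mem f hf hf0)
  · rw [Submodule.isOrtho_iff_le, Submodule.le_orthogonal_iff_le_orthogonal]
    rintro _ ⟨d, _, rfl⟩
    exact Mᗮ.starProjection_apply_mem d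

lemma exists_kerBlock_basis (G : LpMat p n) :
    ∃ (r : ℕ) (W : Fin r → hardyVec 2 n × hardyVec q n), (∀ i, W i ∈ kerBlock Θ q G) ∧
      LinearIndependent ℂ (fun i => evalZeroPair q n (W i)) ∧
      ∀ F ∈ kerBlock Θ q G,
        evalZeroPair q n F ∈ Submodule.span ℂ (Set.range fun i => evalZeroPair q n (W i)) := by
  let E := (kerBlock Θ q G).map (evalZeroPair q n)
  let b := Module.finBasis ℂ E
  choose W hW hWb using fun i => Submodule.mem_map.1 (b i).2
  refine ⟨_, W, hW, ?_, fun F hF => ?_⟩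
  · simp only [hWb]
    exact b.linearIndependent.map' E.subtype E.ker_subtype
  · simp only [hWb]
    have h := congrArg (Submodule.map E.subtype) b.span_eq
    rw [Submodule.map_span, Submodule.map_top, Submodule.range_subtype, ← Set.range_comp] at h
    change _ ∈ Submodule.span ℂ (Set.range (E.subtype ∘ b))
    rw [h]
    exact Submodule.mem_map_of_mem hF

end Defect

end MTTO

theorem mainTheorem2 {n : ℕ} {p q : ℝ≥0∞} [Fact (1 ≤ q)] [ENNReal.HolderTriple p 2 q]
    (hp : 2 < p) (Θ : MTTO.InnerMatrix n) (G : MTTO.LpMat p n)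
    (hG : MTTO.IsMTTO Θ (MTTO.inclMat hp.le G)) :
    (∃ m ≤ n, MTTO.IsNearlyInvariantWithDefect (MTTO.kerMTTO Θ (MTTO.inclMat hp.le G)) m) ∧
    ∀ (r : ℕ) (W : Fin r → MTTO.hardyVec 2 n × MTTO.hardyVec q n),
      (∀ i, W i ∈ MTTO.kerBlockToeplitz q Θ G) →
      LinearIndependent ℂ (fun i => MTTO.evalZeroPair q n (W i)) →
      (Submodule.span ℂ (Set.range fun i => MTTO.evalZeroPair q n (W i)) :
        Set ((Fin n → ℂ) × (Fin n → ℂ))) =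
          MTTO.evalZeroPair q n '' MTTO.kerBlockToeplitz q Θ G →
      MTTO.IsDefectSpace (MTTO.kerMTTO Θ (MTTO.inclMat hp.le G)) (MTTO.explicitDefect W) ∧
        Module.finrank ℂ (MTTO.explicitDefect W) ≤ n := by
  constructor
  · obtain ⟨r, W, hW, hli, hspan⟩ := MTTO.exists_kerBlock_basis (q := q) Θ G
    obtain ⟨m, hm, h⟩ :=
      (MTTO.isDefectSpace_explicitDefect Θ hp hG hW hspan).exists_isNearlyInvariantWithDefect
        (MTTO.kerMTTO_le_hardyVec Θ _) (MTTO.isClosed_kerMTTO Θ _)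
    exact ⟨m, hm.trans (MTTO.finrank_explicitDefect_le hli), h⟩
  · intro r W hW hli hspan
    refine ⟨MTTO.isDefectSpace_explicitDefect Θ hp hG hW fun F hF => ?_,
      MTTO.finrank_explicitDefect_le hli⟩
    exact hspan.ge (Set.mem_image_of_mem _ hF)
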